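/- **Theorem 3.3.** Let $\alpha>0$ be real, $k=\lceil\alpha\rceil$ (so $k-1<\alpha\le k$), and equip $\mathbf R^n$, $\mathbf R^m$ with arbitrary norms and matrices with the induced norms. Consider the delay-free Caputo system $$(D^\alpha_{0+}x)(t)=\sum_{i=0}^r\big(A_i+\tilde A_i(t)\big)x(t)+B(t)u(t),\qquad t>0,$$ with constant matrices $A_i\in\mathbf R^{n\times n}$ and bounded piecewise continuous $\tilde A_i:[0,\infty)\to\mathbf R^{n\times n}$, $B:[0,\infty)\to\mathbf R^{n\times m}$, under a feedback control $$u(t)=\sum_{i=0}^r K_i(x_{it},t)\,x(t),$$ where $x_{it}$ is the restriction of the trajectory $x$ to $[\max(0,t-d_i),t]$ for given $d_i\ge 0$. Here $(D^\alpha_{0+}x)(t)=\frac1{\Gamma(k-\alpha)}\int_0^t\frac{x^{(k)}(\tau)}{(t-\tau)^{\alpha+1-k}}d\tau$ if $\alpha<k$, and $D^k_{0+}x=x^{(k)}$. A trajectory is a function $x$ of class $C^{k-1}$ on $[0,\infty)$, with $x^{(k-1)}$ absolutely continuous on every $[0,T]$, that satisfies the closed-loop equation for almost every $t>0$. For a matrix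 $M\in\mathbf R^{n\times n}$ put, with $E_{\alpha,\beta}(N)=\sum_{\ell\ge0}N^\ell/\Gamma(\alpha\ell+\beta)$, $$\bar\Phi_{\alpha j}(t)=t^jE_{\alpha,j+1}(Mt^\alpha)\ (0\le j\le k-1),\qquad \bar\Phi_\alpha(t)=t^{\alpha-1}E_{\alpha,\alpha}(Mt^\alpha).$$ Let $K_{0j}:[0,\infty)\to\mathbf R$ $(0\le j\le k-1)$ be functions and $\bar K_0,\bar K_1$ be finite real constants such that 1. $\|\bar\Phi_{\alpha j}(t)\|\le K_{0j}(t)\le\bar K_0$ for all $t\ge0$ and $0\le j\le k-1$; 2. $\bar\Phi_\alpha\in L^1(0,\infty)$ and $\sup_{t\ge0}\int_0^t\|\bar\Phi_\alpha(t-\tau)\|\,d\tau\le\bar K_1$. Write $\|F\|_\infty=\sup_{t\ge0}\|F(t)\|$. (i) Let $M=\sum_{i=0}^rA_i$. Suppose $\|K_i(x_{it},t)\|\le K_i^0<\infty$ along every trajectory, for $t\ge0$ and $0\le i\le r$, and $$\bar K_1\sum_{i=0}^r\big(\|\tilde A_i\|_\infty+\|B\|_\infty K_i^0\big)<1 .$$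 Then the closed-loop system is globally stable. If in addition $K_{0j}(t)\to0$ as $t\to\infty$ for $0\le j\le k-1$, it is globally asymptotically stable to the zero equilibrium. (ii) Suppose $K_0(x_{0t},t)=K_0^0$ is a constant matrix along every trajectory, the matrix $BK_0^0=B(t)K_0^0$ does not depend on $t\ge 0$ (as when $B$ is constant), and let $M=\sum_{i=0}^rA_i+BK_0^0$. Suppose $\|K_i(x_{it},t)\|\le K_i^0<\infty$ along every trajectory, for $t\ge0$ and $1\le i\le r$, and $$\bar K_1\Big(\sum_{i=0}^r\|\tilde A_i\|_\infty+\|B\|_\infty\sum_{i=1}^rK_i^0\Big)<1 .$$ Then the two conclusions of (i) hold. Here *globally stable* means: $x\equiv0$ is a trajectory; for each $\varepsilon>0$ there is $\delta>0$ such that every trajectory with $\|x^{(j)}(0)\|<\delta$ for $0\le j\le k-1$ satisfies $\|x(t)\|<\varepsilon$ for all $t\ge0$; and for each $R$ there is $C$ such that every trajectory with $\|x^{(j)}(0)\|\le R$ for $0\le j\le k-1$ satisfies $\|x(t)\|\le C$ for all $t\ge0$. *Globally asymptotically stable* means in addition that every trajectory tends to $0$ as $t\to\infty$. -/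

import Mathlib

open Set Filter Topology MeasureTheory
open scoped BigOperators

noncomputable section

namespace CaputoSystem

/-- `k = ⌈α⌉`, the positive integer with `k - 1 < α ≤ k` (for `α > 0`). -/
def order (α : ℝ) : ℕ := ⌈α⌉₊

/-- The `j`-th derivative of a trajectory on the half-line `[0, ∞)` (one-sided at `0`). -/
def dtime {E : Type*} [NormedAddCommGroup E] [NormedSpace ℝ E]
    (j : ℕ) (x : ℝ → E) : ℝ → E :=
  iteratedDerivWithin j x (Ici 0)

/-- The Caputo derivative of real order `α > 0` based at `0`:
`(1 / Γ(k - α)) ∫₀ᵗ x⁽ᵏ⁾(τ) / (t - τ)^(α + 1 - k) dτ` if `k - 1 < α < k`, and `x⁽ᵏ⁾(t)` if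
`α = k` is an integer. -/
def caputoDeriv {E : Type*} [NormedAddCommGroup E] [NormedSpace ℝ E]
    (α : ℝ) (x : ℝ → E) (t : ℝ) : E :=
  if α = (order α : ℝ) then dtime (order α) x t
  else (1 / Real.Gamma ((order α : ℝ) - α)) •
    ∫ τ in (0 : ℝ)..t, (1 / (t - τ) ^ (α + 1 - (order α : ℝ))) • dtime (order α) x τ

/-- The regularity under which the Caputo derivative of order `α` is defined (almost everywhere)
by the formula above: `x` is `C^(k-1)` on `[0, ∞)` and `x⁽ᵏ⁻¹⁾` is absolutely continuous on every
`[0, T]`. -/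
def CaputoRegular {E : Type*} [NormedAddCommGroup E] [NormedSpace ℝ E]
    (α : ℝ) (x : ℝ → E) : Prop :=
  ContDiffOn ℝ ((order α - 1 : ℕ) : ℕ∞) x (Ici 0) ∧
    ∀ T : ℝ, 0 ≤ T → AbsolutelyContinuousOnInterval (dtime (order α - 1) x) 0 T

/-- Mittag-Leffler function of a bounded operator: `E_{α,β}(M) = ∑ M^ℓ / Γ(α ℓ + β)`. -/
def mittagLeffler {E : Type*} [NormedAddCommGroup E] [NormedSpace ℝ E]
    (α β : ℝ) (M : E →L[ℝ] E) : E →L[ℝ] E :=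
  ∑' ℓ : ℕ, (1 / Real.Gamma (α * ℓ + β)) • M ^ ℓ

/-- `Φ_{αj}(t) = t^j E_{α,j+1}(M t^α)`. -/
def PhiJ {E : Type*} [NormedAddCommGroup E] [NormedSpace ℝ E]
    (α : ℝ) (M : E →L[ℝ] E) (j : ℕ) (t : ℝ) : E →L[ℝ] E :=
  t ^ j • mittagLeffler α ((j : ℝ) + 1) (t ^ α • M)

/-- `Φ_α(t) = t^(α-1) E_{α,α}(M t^α)`. -/
def Phi {E : Type*} [NormedAddCommGroup E] [NormedSpace ℝ E]
    (α : ℝ) (M : E →L[ℝ] E) (t : ℝ) : E →L[ℝ] E :=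
  t ^ (α - 1) • mittagLeffler α α (t ^ α • M)

/-- Piecewise continuity on `[0, ∞)`: finitely many discontinuities in each bounded interval.
Boundedness is required separately, and one-sided limits at the discontinuities are not needed. -/
def PiecewiseContinuous {F : Type*} [TopologicalSpace F] (f : ℝ → F) : Prop :=
  ∀ T : ℝ, {t ∈ Icc (0 : ℝ) T | ¬ ContinuousWithinAt f (Ici 0) t}.Finite

/-- `f` is bounded on `[0, ∞)`. -/
def BoundedOnHalfLine {F : Type*} [Norm F] (f : ℝ → F) : Prop :=
  BddAbove (range fun t : Ici (0 : ℝ) => ‖f t‖)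

/-- `‖f‖_∞ = sup_{t ≥ 0} ‖f(t)‖` (for bounded `f`). -/
def supNorm {F : Type*} [Norm F] (f : ℝ → F) : ℝ :=
  ⨆ t : Ici (0 : ℝ), ‖f t‖

/-- Data of a Caputo system with all delays equal to zero,
`(D^α x)(t) = ∑_{i=0}^r (A_i + Ã_i(t)) x(t) + B(t) u(t)`, in which the coefficient functions are
bounded and piecewise continuous. The state space `E` and the control space `U` are `ℝⁿ` and `ℝᵐ`
with arbitrary norms, and matrices (linear maps) carry the induced norms. -/
structure LinearSystem (E U : Type*) [NormedAddCommGroup E] [NormedSpace ℝ E]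
    [NormedAddCommGroup U] [NormedSpace ℝ U] (r : ℕ) where
  α : ℝ
  α_pos : 0 < α
  A : Fin (r + 1) → (E →L[ℝ] E)
  At : Fin (r + 1) → ℝ → (E →L[ℝ] E)
  At_pc : ∀ i, PiecewiseContinuous (At i)
  At_bdd : ∀ i, BoundedOnHalfLine (At i)
  B : ℝ → (U →L[ℝ] E)
  B_pc : PiecewiseContinuous B
  B_bdd : BoundedOnHalfLine B

/-- The strip of the trajectory `x` on `[max(0, t - d), t]`, truncated to zero elsewhere.
For `d = 0` and `t ≥ 0` it carries exactly the value `x t`. -/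
def strip {E : Type*} [NormedAddCommGroup E] (d : ℝ) (x : ℝ → E) (t : ℝ) : ℝ → E :=
  (Icc (max 0 (t - d)) t).indicator x

/-- State-feedback gains `K_i(x_{it}, t)`, where `x_{it}` is the strip of the trajectory over a
window of length `window i`. -/
structure Feedback (E U : Type*) [NormedAddCommGroup E] [NormedSpace ℝ E]
    [NormedAddCommGroup U] [NormedSpace ℝ U] (r : ℕ) where
  window : Fin (r + 1) → ℝ
  window_nonneg : ∀ i, 0 ≤ window i
  gain : Fin (r + 1) → (ℝ → E) → ℝ → (E →L[ℝ] U)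

section

variable {E U : Type*} [NormedAddCommGroup E] [NormedSpace ℝ E]
  [NormedAddCommGroup U] [NormedSpace ℝ U] {r : ℕ}

/-- The gain `K_i(x_{it}, t)` along the trajectory `x`. -/
def Feedback.along (K : Feedback E U r) (i : Fin (r + 1)) (x : ℝ → E) (t : ℝ) : E →L[ℝ] U :=
  K.gain i (strip (K.window i) x t) t

/-- The control `u(t) = ∑_{i=0}^r K_i(x_{it}, t) x(t)`. -/
def Feedback.control (K : Feedback E U r) (x : ℝ → E) (t : ℝ) : U :=
  ∑ i, K.along i x t (x t)

/-- `x` is a state trajectory on `[0, ∞)` of the system under the feedback control. -/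
def LinearSystem.IsTrajectory (S : LinearSystem E U r) (K : Feedback E U r) (x : ℝ → E) : Prop :=
  CaputoRegular S.α x ∧
    ∀ᵐ t ∂(volume.restrict (Ioi (0 : ℝ))),
      caputoDeriv S.α x t = ∑ i, (S.A i + S.At i t) (x t) + S.B t (K.control x t)

/-- Global (Lyapunov) stability of the closed loop: zero is an equilibrium, trajectories with small
initial data `x⁽ʲ⁾(0)`, `0 ≤ j ≤ k-1`, stay small, and all trajectories are bounded,
uniformly for initial data in bounded sets. -/
def LinearSystem.GloballyStable (S : LinearSystem E U r) (K : Feedback E U r) : Prop :=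
  S.IsTrajectory K (fun _ => 0) ∧
  (∀ ε : ℝ, 0 < ε → ∃ δ : ℝ, 0 < δ ∧ ∀ x : ℝ → E, S.IsTrajectory K x →
    (∀ j < order S.α, ‖dtime j x 0‖ < δ) → ∀ t : ℝ, 0 ≤ t → ‖x t‖ < ε) ∧
  (∀ R : ℝ, ∃ C : ℝ, ∀ x : ℝ → E, S.IsTrajectory K x →
    (∀ j < order S.α, ‖dtime j x 0‖ ≤ R) → ∀ t : ℝ, 0 ≤ t → ‖x t‖ ≤ C)

/-- Global asymptotic stability to the zero equilibrium. -/
def LinearSystem.GloballyAsymptoticallyStable (S : LinearSystem E U r) (K : Feedback E U r) :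
    Prop :=
  S.GloballyStable K ∧ ∀ x : ℝ → E, S.IsTrajectory K x → Tendsto x atTop (𝓝 0)

end

/-- The two bounds on the Mittag-Leffler matrix functions generated by `M`:
`‖Φ_{αj}(t)‖ ≤ K_{0j}(t) ≤ K₀` for `0 ≤ j ≤ k-1` and `t ≥ 0`; and `Φ_α ∈ L¹(0, ∞)` with
`sup_{t ≥ 0} ∫₀ᵗ ‖Φ_α(t - τ)‖ dτ ≤ K₁`. -/
def PhiBounds {E : Type*} [NormedAddCommGroup E] [NormedSpace ℝ E]
    (α : ℝ) (M : E →L[ℝ] E) (K0j : ℕ → ℝ → ℝ) (K0 K1 : ℝ) : Prop :=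
  (∀ j < order α, ∀ t : ℝ, 0 ≤ t → ‖PhiJ α M j t‖ ≤ K0j j t ∧ K0j j t ≤ K0) ∧
  IntegrableOn (Phi α M) (Ioi 0) ∧
  ∀ t : ℝ, 0 ≤ t → ∫ τ in (0 : ℝ)..t, ‖Phi α M (t - τ)‖ ≤ K1

end CaputoSystem

end

/-!
The closed loop is treated as a bounded perturbation of `D^α x = M x`. Writing `f = D^α x - M x`, a
trajectory satisfies the variation of constants formula
`x(t) = ∑ⱼ Φ_{αj}(t) x⁽ʲ⁾(0) + ∫₀ᵗ Φ_α(t - s) f(s) ds` (`CaputoRegular.eq_PhiJ_add_integral_Phi`),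
and the hypotheses on the coefficients and gains give `‖f(t)‖ ≤ c ‖x(t)‖` for almost every `t`, with
`q = K₁ c < 1`. Evaluating at a point where `‖x‖` is maximal on `[0, t]` gives
`(1 - q) ‖x(t)‖ ≤ ∑ⱼ K₀ ‖x⁽ʲ⁾(0)‖`, which is stability and boundedness. If `K_{0j} → 0`, then, as
`Φ_α` is integrable, the formula also gives `limsup ‖x‖ ≤ q limsup ‖x‖`, so `x → 0`. Both parts of
the theorem are instances of `LinearSystem.stable_of_perturbation_bound`, with different `M`.

For the variation of constants formula, let `J^a` be the Riemann–Liouville integral of order `a`.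
The Beta integral and Fubini give `J^a J^b = J^(a+b)` (`rlIntegral_rlIntegral`). Since `D^α x` is
`J^(k-α) x⁽ᵏ⁾`, Taylor's formula with integral remainder reads
`x(t) = ∑ⱼ tʲ / j! x⁽ʲ⁾(0) + J^α D^α x` (`eq_taylor_add_rlIntegral_caputoDeriv`), where the
fundamental theorem of calculus for the absolutely continuous function `x⁽ᵏ⁻¹⁾` is used. This is a
Volterra equation `x = p + J^α f + M J^α x`; substituting it into itself produces the partial sums of
the Mittag-Leffler series and a remainder `M^N J^(αN) x`, which tends to zero because the Gamma
function grows faster than every exponential (`eq_PhiJ_add_integral_Phi`).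
-/

namespace CaputoSystem

/-! ### The Riemann–Liouville kernel -/

/-- The Riemann–Liouville kernel `t ^ (a - 1) / Γ(a)` of order `a`, of interest for `t ≥ 0`. At
`t = 0` the convention `0 ^ 0 = 1` gives it the value `1` for `a = 1`, which agrees with the constant
function `rlKernel 1`; for every other order it vanishes there. -/
noncomputable def rlKernel (a t : ℝ) : ℝ := t ^ (a - 1) / Real.Gamma a

lemma rlKernel_nonneg {a t : ℝ} (ha : 0 < a) (ht : 0 ≤ t) : 0 ≤ rlKernel a t :=
  div_nonneg (Real.rpow_nonneg ht _) (Real.Gamma_pos_of_pos ha).le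

lemma rlKernel_pos {a t : ℝ} (ha : 0 < a) (ht : 0 < t) : 0 < rlKernel a t :=
  div_pos (Real.rpow_pos_of_pos ht _) (Real.Gamma_pos_of_pos ha)

lemma measurable_rlKernel (a : ℝ) : Measurable (rlKernel a) := by
  unfold rlKernel; fun_prop

lemma rlKernel_one (t : ℝ) : rlKernel 1 t = 1 := by simp [rlKernel]

lemma rlKernel_zero {a : ℝ} (ha : a ≠ 1) : rlKernel a 0 = 0 := by
  simp [rlKernel, Real.zero_rpow (sub_ne_zero.2 ha)]

lemma rlKernel_mono {a s t : ℝ} (ha : 1 ≤ a) (hs : 0 ≤ s) (hst : s ≤ t) :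
    rlKernel a s ≤ rlKernel a t := by
  unfold rlKernel
  have := (Real.Gamma_pos_of_pos (by linarith : 0 < a)).le
  gcongr

/-- The kernels form a convolution semigroup: this is Euler's Beta integral. -/
lemma integral_rlKernel_mul_rlKernel {a b t : ℝ} (ha : 0 < a) (hb : 0 < b) (ht : 0 < t) :
    ∫ s in (0 : ℝ)..t, rlKernel a (t - s) * rlKernel b s = rlKernel (a + b) t := by
  have h1 : ∫ s in (0 : ℝ)..t, s ^ (b - 1) * (t - s) ^ (a - 1)
      = t ^ (a + b - 1) * (Real.Gamma a * Real.Gamma b / Real.Gamma (a + b)) := by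
    have h := Complex.betaIntegral_scaled (b : ℂ) (a : ℂ) ht
    have hB := Complex.Gamma_mul_Gamma_eq_betaIntegral (s := (b : ℂ)) (t := (a : ℂ))
      (by simpa) (by simpa)
    rw [← Complex.ofReal_add, Complex.Gamma_ofReal, Complex.Gamma_ofReal, Complex.Gamma_ofReal]
      at hB
    have hG : ((Real.Gamma (b + a) : ℝ) : ℂ) ≠ 0 :=
      Complex.ofReal_ne_zero.2 (Real.Gamma_pos_of_pos (by linarith)).ne'
    have hB' : Complex.betaIntegral (b : ℂ) a
        = ((Real.Gamma a * Real.Gamma b / Real.Gamma (a + b) : ℝ) : ℂ) := by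
      rw [add_comm a b, Complex.ofReal_div, eq_div_iff hG, mul_comm, ← hB, Complex.ofReal_mul,
        mul_comm]
    rw [hB'] at h
    have e1 : ∫ s in (0 : ℝ)..t, (s : ℂ) ^ ((b : ℂ) - 1) * ((t : ℂ) - s) ^ ((a : ℂ) - 1)
        = ((∫ s in (0 : ℝ)..t, s ^ (b - 1) * (t - s) ^ (a - 1) : ℝ) : ℂ) := by
      rw [← intervalIntegral.integral_ofReal]
      refine intervalIntegral.integral_congr fun s hs => ?_
      rw [uIcc_of_le ht.le] at hs
      push_cast
      rw [Complex.ofReal_cpow hs.1, Complex.ofReal_cpow (by linarith [hs.2])]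
      push_cast; rfl
    rw [e1] at h
    have e2 : (t : ℂ) ^ ((b : ℂ) + a - 1) = ((t ^ (a + b - 1) : ℝ) : ℂ) := by
      rw [Complex.ofReal_cpow ht.le]; push_cast; ring_nf
    rw [e2] at h
    exact_mod_cast h
  have ga := (Real.Gamma_pos_of_pos ha).ne'
  have gb := (Real.Gamma_pos_of_pos hb).ne'
  have e : ∀ s, rlKernel a (t - s) * rlKernel b s
      = (1 / (Real.Gamma a * Real.Gamma b)) * (s ^ (b - 1) * (t - s) ^ (a - 1)) := by
    intro s; unfold rlKernel; field_simp
  simp_rw [e]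
  rw [intervalIntegral.integral_const_mul, h1]
  unfold rlKernel
  field_simp

lemma integral_rlKernel_shift {a b s t : ℝ} (ha : 0 < a) (hb : 0 < b) (hst : s < t) :
    ∫ τ in s..t, rlKernel a (t - τ) * rlKernel b (τ - s) = rlKernel (a + b) (t - s) := by
  rw [← integral_rlKernel_mul_rlKernel ha hb (sub_pos.2 hst)]
  have := intervalIntegral.integral_comp_sub_right (a := s) (b := t)
    (fun τ => rlKernel a (t - s - τ) * rlKernel b τ) s
  simp only [sub_self] at this
  rw [← this]
  simp

/-- The convolution integral converges, since its value is not the `0` that a divergent integral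
would have. -/
lemma integrableOn_rlKernel_shift {a b s t : ℝ} (ha : 0 < a) (hb : 0 < b) (hst : s < t) :
    IntegrableOn (fun τ => rlKernel a (t - τ) * rlKernel b (τ - s)) (Ioc s t) := by
  by_contra h
  have h1 := integral_rlKernel_shift ha hb hst
  rw [intervalIntegral.integral_of_le hst.le, integral_undef h] at h1
  exact (rlKernel_pos (add_pos ha hb) (sub_pos.2 hst)).ne h1

lemma integrableOn_rlKernel_sub {a t : ℝ} (ha : 0 < a) :
    IntegrableOn (fun τ => rlKernel a (t - τ)) (Ioc 0 t) := by
  rcases le_or_gt t 0 with ht | ht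
  · simp [Ioc_eq_empty_of_le ht]
  · simpa [rlKernel_one] using integrableOn_rlKernel_shift ha one_pos ht

lemma integral_rlKernel_sub {a t : ℝ} (ha : 0 < a) (ht : 0 ≤ t) :
    ∫ τ in (0 : ℝ)..t, rlKernel a (t - τ) = rlKernel (a + 1) t := by
  rcases ht.eq_or_lt with rfl | ht
  · simp [rlKernel_zero (by linarith : a + 1 ≠ 1)]
  · simpa [rlKernel_one] using integral_rlKernel_shift ha one_pos ht

/-- A lower bound showing that `Γ` grows faster than every exponential: keep only the part of
Euler's integral over `(s, ∞)`. -/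
lemma rpow_mul_exp_le_Gamma {s x : ℝ} (hs : 0 < s) (hx : 1 ≤ x) :
    s ^ (x - 1) * Real.exp (-s) ≤ Real.Gamma x := by
  have hx0 : 0 < x := by linarith
  rw [Real.Gamma_eq_integral hx0, ← integral_exp_neg_Ioi, ← integral_const_mul]
  have hi := Real.GammaIntegral_convergent hx0
  calc ∫ t in Ioi s, s ^ (x - 1) * Real.exp (-t)
      ≤ ∫ t in Ioi s, Real.exp (-t) * t ^ (x - 1) := by
        refine setIntegral_mono_on ?_ (hi.mono_set (Ioi_subset_Ioi hs.le)) measurableSet_Ioi ?_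
        · exact (integrableOn_exp_neg_Ioi s).const_mul _
        · intro t ht
          rw [mul_comm]
          have : s ≤ t := le_of_lt ht
          gcongr
    _ ≤ _ := by
        refine setIntegral_mono_set hi ?_ (Ioi_subset_Ioi hs.le).eventuallyLE
        refine ae_restrict_of_forall_mem measurableSet_Ioi fun t ht => ?_
        have : (0:ℝ) < t := ht
        positivity

/-- Scalar Mittag-Leffler series converge, by comparison with a geometric series. -/
lemma summable_pow_mul_rlKernel {α β R t : ℝ} (hα : 0 < α) (hR : 0 ≤ R) (ht : 0 ≤ t) :
    Summable fun l : ℕ => R ^ l * rlKernel (α * l + β) t := by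
  rcases ht.eq_or_lt with rfl | ht
  · refine summable_of_hasFiniteSupport (Set.Finite.subset (s := {l : ℕ | α * l + β = 1}) ?_ ?_)
    · refine Set.Subsingleton.finite fun a ha b hb => ?_
      simp only [mem_ofPred_eq] at ha hb
      have : (a : ℝ) = b := mul_left_cancel₀ hα.ne' (by linarith)
      exact_mod_cast this
    · intro l hl
      by_contra h
      exact hl (by simp [rlKernel_zero h])
  set s : ℝ := t * (2 * R + 1) ^ (1 / α) with hs
  have hs0 : 0 < s := by positivity
  have hsα : (t / s) ^ α = 1 / (2 * R + 1) := by
    have : t / s = ((2 * R + 1) ^ (1 / α))⁻¹ := by rw [hs]; field_simp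
    rw [this, Real.inv_rpow (by positivity), ← Real.rpow_mul (by positivity)]
    simp [hα.ne']
  have hq : R / (2 * R + 1) < 1 := by rw [div_lt_one (by positivity)]; linarith
  have hgeo := (summable_geometric_of_lt_one (by positivity : 0 ≤ R / (2 * R + 1)) hq).mul_left
    (Real.exp s * (t / s) ^ (β - 1))
  -- With this `s` the Gamma bound makes the `l`-th term at most a constant times
  -- `(R * (t / s) ^ α) ^ l = (R / (2 * R + 1)) ^ l`.
  refine Summable.of_norm_bounded_eventually_nat hgeo ?_
  have hev : ∀ᶠ l : ℕ in atTop, 1 ≤ α * l + β := by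
    have : Tendsto (fun l : ℕ => α * (l : ℝ) + β) atTop atTop :=
      tendsto_atTop_add_const_right _ _ (tendsto_natCast_atTop_atTop.const_mul_atTop hα)
    exact this.eventually_ge_atTop 1
  filter_upwards [hev] with l hl
  have hpos : 0 < α * l + β := by linarith
  rw [Real.norm_of_nonneg (mul_nonneg (pow_nonneg hR _) (rlKernel_nonneg hpos ht.le))]
  have hG := rpow_mul_exp_le_Gamma hs0 hl
  have h1 : rlKernel (α * l + β) t ≤ Real.exp s * (t / s) ^ (α * l + β - 1) := by
    unfold rlKernel
    rw [div_le_iff₀ (Real.Gamma_pos_of_pos hpos)]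
    calc t ^ (α * l + β - 1)
        = Real.exp s * (t / s) ^ (α * l + β - 1) * (s ^ (α * l + β - 1) * Real.exp (-s)) := by
          rw [Real.div_rpow ht.le hs0.le, Real.exp_neg]
          field_simp
      _ ≤ _ := by gcongr
  calc R ^ l * rlKernel (α * l + β) t
      ≤ R ^ l * (Real.exp s * (t / s) ^ (α * l + β - 1)) := by gcongr
    _ = _ := by
      rw [show α * l + β - 1 = α * l + (β - 1) by ring, Real.rpow_add (by positivity),
        Real.rpow_mul (by positivity), hsα, Real.rpow_natCast, div_pow, div_pow]
      field_simp
      simp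

/-! ### Fractional integrals and their semigroup law -/

section FractionalIntegral

variable {E : Type*} [NormedAddCommGroup E] [NormedSpace ℝ E]

/-- The Riemann–Liouville fractional integral of order `a` based at `0`,
`(1 / Γ(a)) ∫₀ᵗ (t - s) ^ (a - 1) h(s) ds`. -/
noncomputable def rlIntegral (a : ℝ) (h : ℝ → E) (t : ℝ) : E :=
  ∫ s in (0 : ℝ)..t, rlKernel a (t - s) • h s

lemma rlIntegral_congr {a t : ℝ} (ht : 0 ≤ t) {f h : ℝ → E}
    (hfh : ∀ᵐ s ∂volume.restrict (Ioc 0 t), f s = h s) : rlIntegral a f t = rlIntegral a h t := by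
  unfold rlIntegral
  rw [intervalIntegral.integral_of_le ht, intervalIntegral.integral_of_le ht]
  refine integral_congr_ae ?_
  filter_upwards [hfh] with s hs
  rw [hs]

lemma aestronglyMeasurable_rlKernel_smul {a T : ℝ} {h : ℝ → E} {μ : Measure ℝ}
    (hh : AEStronglyMeasurable h μ) :
    AEStronglyMeasurable (fun s => rlKernel a (T - s) • h s) μ :=
  (((measurable_rlKernel a).comp (measurable_const.sub measurable_id)).aestronglyMeasurable).smul hh

lemma integrableOn_rlKernel_smul_of_one_le {a T : ℝ} (ha : 1 ≤ a) {h : ℝ → E}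
    (hh : IntegrableOn h (Ioc 0 T)) :
    IntegrableOn (fun s => rlKernel a (T - s) • h s) (Ioc 0 T) := by
  refine Integrable.mono' (hh.norm.const_mul (rlKernel a T))
    (aestronglyMeasurable_rlKernel_smul hh.1) ?_
  refine ae_restrict_of_forall_mem measurableSet_Ioc fun s hs => ?_
  rw [norm_smul, Real.norm_of_nonneg (rlKernel_nonneg (by linarith) (by linarith [hs.2]))]
  gcongr
  exact rlKernel_mono ha (by linarith [hs.2]) (by linarith [hs.1])

lemma integrableOn_rlKernel_smul_of_bounded {a T C : ℝ} (ha : 0 < a) {h : ℝ → E}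
    (hm : AEStronglyMeasurable h (volume.restrict (Ioc 0 T)))
    (hC : ∀ᵐ s ∂volume.restrict (Ioc 0 T), ‖h s‖ ≤ C) :
    IntegrableOn (fun s => rlKernel a (T - s) • h s) (Ioc 0 T) := by
  refine Integrable.mono' ((integrableOn_rlKernel_sub (t := T) ha).mul_const C)
    (aestronglyMeasurable_rlKernel_smul hm) ?_
  filter_upwards [hC, ae_restrict_mem measurableSet_Ioc] with s hs hsT
  have := rlKernel_nonneg ha (by linarith [hsT.2] : 0 ≤ T - s)
  rw [norm_smul, Real.norm_of_nonneg this]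
  gcongr

lemma norm_rlIntegral_le {a T C : ℝ} (ha : 0 < a) (hT : 0 ≤ T) {h : ℝ → E}
    (hC : ∀ᵐ s ∂volume.restrict (Ioc 0 T), ‖h s‖ ≤ C) :
    ‖rlIntegral a h T‖ ≤ rlKernel (a + 1) T * C := by
  rw [← integral_rlKernel_sub ha hT, rlIntegral, intervalIntegral.integral_of_le hT,
    intervalIntegral.integral_of_le hT, ← integral_mul_const]
  refine norm_integral_le_of_norm_le ((integrableOn_rlKernel_sub (t := T) ha).mul_const C) ?_
  filter_upwards [hC, ae_restrict_mem measurableSet_Ioc] with s hs hsT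
  have := rlKernel_nonneg ha (by linarith [hsT.2] : 0 ≤ T - s)
  rw [norm_smul, Real.norm_of_nonneg this]
  gcongr

/-- The integrand of the iterated fractional integral of orders `a` and `b` at time `T`, as a function
of `s` and `τ` on the square `(0, T]²`, cut off to the triangle `s < τ`. -/
noncomputable def rlPair (a b T : ℝ) (h : ℝ → E) (s τ : ℝ) : E :=
  (Ioi s).indicator (fun τ => (rlKernel a (T - τ) * rlKernel b (τ - s)) • h s) τ

lemma rlPair_eq (a b T : ℝ) (h : ℝ → E) (s τ : ℝ) : rlPair a b T h s τ =
    ({p : ℝ × ℝ | p.1 < p.2}.indicator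
      (fun p => rlKernel a (T - p.2) * rlKernel b (p.2 - p.1)) (s, τ)) • h s := by
  unfold rlPair
  by_cases hs : s < τ
  · rw [indicator_of_mem (by exact hs), indicator_of_mem (by exact hs)]
  · rw [indicator_of_notMem (by exact hs), indicator_of_notMem (by exact hs), zero_smul]

lemma setIntegral_indicator_Ioi {F : Type*} [NormedAddCommGroup F] [NormedSpace ℝ F]
    {s T : ℝ} (hs : 0 ≤ s) (f : ℝ → F) :
    ∫ τ in Ioc 0 T, (Ioi s).indicator f τ = ∫ τ in Ioc s T, f τ := by
  rw [setIntegral_indicator measurableSet_Ioi, inter_comm]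
  congr 2
  ext x; simp only [mem_inter_iff, mem_Ioi, mem_Ioc]
  constructor
  · rintro ⟨h1, h2, h3⟩; exact ⟨h1, h3⟩
  · rintro ⟨h1, h2⟩; exact ⟨h1, by linarith, h2⟩

/-- Integrating the norm over `τ` first collapses the two kernels to one of order `a + b`, so
absolute integrability on the triangle is that of `rlKernel (a + b) (T - ·) • h`. -/
lemma integrable_rlPair {a b T : ℝ} (ha : 0 < a) (hb : 0 < b) {h : ℝ → E}
    (hm : AEStronglyMeasurable h (volume.restrict (Ioc 0 T)))
    (hi : IntegrableOn (fun s => rlKernel (a + b) (T - s) • h s) (Ioc 0 T)) :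
    Integrable (Function.uncurry (rlPair a b T h))
      ((volume.restrict (Ioc 0 T)).prod (volume.restrict (Ioc 0 T))) := by
  have hmeas : AEStronglyMeasurable (Function.uncurry (rlPair a b T h))
      ((volume.restrict (Ioc 0 T)).prod (volume.restrict (Ioc 0 T))) := by
    have e : Function.uncurry (rlPair a b T h) = fun p : ℝ × ℝ =>
        ({p : ℝ × ℝ | p.1 < p.2}.indicator
          (fun p => rlKernel a (T - p.2) * rlKernel b (p.2 - p.1)) p) • h p.1 := by
      ext p; exact rlPair_eq a b T h p.1 p.2
    rw [e]
    refine AEStronglyMeasurable.smul ?_ (hm.comp_fst)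
    refine Measurable.aestronglyMeasurable (Measurable.indicator ?_ ?_)
    · exact ((measurable_rlKernel a).comp (measurable_const.sub measurable_snd)).mul
        ((measurable_rlKernel b).comp (measurable_snd.sub measurable_fst))
    · exact measurableSet_lt measurable_fst measurable_snd
  rw [integrable_prod_iff hmeas]
  have hne : ∀ᵐ s : ℝ ∂volume.restrict (Ioc 0 T), s < T := by
    filter_upwards [ae_restrict_mem measurableSet_Ioc, ae_restrict_of_ae (Measure.ae_ne volume T)]
      with s hs hsT
    exact lt_of_le_of_ne hs.2 hsT
  have hin : ∀ᵐ s : ℝ ∂volume.restrict (Ioc 0 T), s ∈ Ioo 0 T := by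
    filter_upwards [ae_restrict_mem measurableSet_Ioc, hne] with s hs hsT
    exact ⟨hs.1, hsT⟩
  constructor
  · filter_upwards [hin] with s hs
    have h1 := (integrableOn_rlKernel_shift ha hb hs.2).smul_const (h s)
    change Integrable (fun τ => (Ioi s).indicator
      (fun τ => (rlKernel a (T - τ) * rlKernel b (τ - s)) • h s) τ) _
    rw [integrable_indicator_iff measurableSet_Ioi]
    change Integrable _ ((volume.restrict (Ioc 0 T)).restrict (Ioi s))
    rw [Measure.restrict_restrict measurableSet_Ioi]
    refine IntegrableOn.mono_set h1 ?_
    rintro τ ⟨h1, h2⟩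
    exact ⟨h1, h2.2⟩
  · refine hi.norm.congr ?_
    filter_upwards [hin] with s hs
    have e : ∀ τ, ‖Function.uncurry (rlPair a b T h) (s, τ)‖ = (Ioi s).indicator
        (fun τ => ‖(rlKernel a (T - τ) * rlKernel b (τ - s)) • h s‖) τ := by
      intro τ
      exact norm_indicator_eq_indicator_norm
        (fun τ => (rlKernel a (T - τ) * rlKernel b (τ - s)) • h s) τ
    simp_rw [e]
    rw [setIntegral_indicator_Ioi hs.1.le]
    have e2 : ∫ τ in Ioc s T, ‖(rlKernel a (T - τ) * rlKernel b (τ - s)) • h s‖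
        = ∫ τ in Ioc s T, (rlKernel a (T - τ) * rlKernel b (τ - s)) * ‖h s‖ := by
      refine setIntegral_congr_fun measurableSet_Ioc fun τ hτ => ?_
      rw [norm_smul, Real.norm_of_nonneg]
      exact mul_nonneg (rlKernel_nonneg ha (by linarith [hτ.2]))
        (rlKernel_nonneg hb (by linarith [hτ.1]))
    rw [e2, integral_mul_const, ← intervalIntegral.integral_of_le hs.2.le,
      integral_rlKernel_shift ha hb hs.2, norm_smul, Real.norm_of_nonneg]
    exact rlKernel_nonneg (add_pos ha hb) (by linarith [hs.2])

lemma integral_rlPair_fst {a b T τ : ℝ} (hτ : τ ∈ Ioc 0 T) (h : ℝ → E) :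
    ∫ s in Ioc 0 T, rlPair a b T h s τ = rlKernel a (T - τ) • rlIntegral b h τ := by
  have e : ∀ s, rlPair a b T h s τ = (Iio τ).indicator
      (fun s => rlKernel a (T - τ) • rlKernel b (τ - s) • h s) s := by
    intro s
    unfold rlPair
    by_cases hs : s < τ
    · rw [indicator_of_mem (by exact hs), indicator_of_mem (by exact hs), mul_smul]
    · rw [indicator_of_notMem (by exact hs), indicator_of_notMem (by exact hs)]
  simp_rw [e]
  rw [setIntegral_indicator measurableSet_Iio, rlIntegral,
    intervalIntegral.integral_of_le hτ.1.le, integral_Ioc_eq_integral_Ioo, ← integral_smul]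
  congr 2
  ext x; simp only [mem_inter_iff, mem_Iio, mem_Ioc, mem_Ioo]
  constructor
  · rintro ⟨⟨h1, _⟩, h3⟩; exact ⟨h1, h3⟩
  · rintro ⟨h1, h2⟩; exact ⟨⟨h1, by linarith [hτ.2]⟩, h2⟩

lemma integrableOn_rlKernel_smul_rlIntegral {a b T : ℝ} (ha : 0 < a) (hb : 0 < b) {h : ℝ → E}
    (hm : AEStronglyMeasurable h (volume.restrict (Ioc 0 T)))
    (hi : IntegrableOn (fun s => rlKernel (a + b) (T - s) • h s) (Ioc 0 T)) :
    IntegrableOn (fun τ => rlKernel a (T - τ) • rlIntegral b h τ) (Ioc 0 T) := by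
  refine (integrable_rlPair ha hb hm hi).integral_prod_right.congr ?_
  filter_upwards [ae_restrict_mem measurableSet_Ioc] with τ hτ
  exact integral_rlPair_fst hτ h

/-- Semigroup law for fractional integrals, by Fubini on the triangle `s < τ`. The integrability
hypothesis covers both integrable `h` with `1 ≤ a + b` and bounded `h` with any positive orders. -/
theorem rlIntegral_rlIntegral [CompleteSpace E] {a b T : ℝ} (ha : 0 < a) (hb : 0 < b) (hT : 0 ≤ T)
    {h : ℝ → E}
    (hm : AEStronglyMeasurable h (volume.restrict (Ioc 0 T)))
    (hi : IntegrableOn (fun s => rlKernel (a + b) (T - s) • h s) (Ioc 0 T)) :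
    rlIntegral a (rlIntegral b h) T = rlIntegral (a + b) h T := by
  have hsw := integral_integral_swap (integrable_rlPair ha hb hm hi)
  rw [rlIntegral, rlIntegral, intervalIntegral.integral_of_le hT,
    intervalIntegral.integral_of_le hT]
  rw [← setIntegral_congr_fun measurableSet_Ioc fun τ hτ => integral_rlPair_fst hτ h, ← hsw]
  refine integral_congr_ae ?_
  filter_upwards [ae_restrict_mem measurableSet_Ioc, ae_restrict_of_ae (Measure.ae_ne volume T)]
      with s hs hsT
  have hsT' := lt_of_le_of_ne hs.2 hsT
  unfold rlPair
  rw [setIntegral_indicator_Ioi hs.1.le, integral_smul_const,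
    ← intervalIntegral.integral_of_le hs.2, integral_rlKernel_shift ha hb hsT']

/-- Fractional integration of the power functions. The restriction `1 ≤ b` makes the formula true
at `t = 0` as well. -/
lemma rlIntegral_rlKernel [CompleteSpace E] {a b t : ℝ} (ha : 0 < a) (hb : 1 ≤ b) (ht : 0 ≤ t)
    (v : E) :
    rlIntegral a (fun s => rlKernel b s • v) t = rlKernel (a + b) t • v := by
  have e : rlIntegral a (fun s => rlKernel b s • v) t
      = (∫ s in (0 : ℝ)..t, rlKernel a (t - s) * rlKernel b s) • v := by
    rw [rlIntegral, ← intervalIntegral.integral_smul_const]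
    simp_rw [mul_smul]
  rw [e]
  rcases ht.eq_or_lt with rfl | ht
  · simp [rlKernel_zero (by linarith : a + b ≠ 1)]
  · rw [integral_rlKernel_mul_rlKernel ha (by linarith) ht]

lemma rlIntegral_add {a T : ℝ} (hT : 0 ≤ T) {f h : ℝ → E}
    (hf : IntegrableOn (fun s => rlKernel a (T - s) • f s) (Ioc 0 T))
    (hh : IntegrableOn (fun s => rlKernel a (T - s) • h s) (Ioc 0 T)) :
    rlIntegral a (fun s => f s + h s) T = rlIntegral a f T + rlIntegral a h T := by
  unfold rlIntegral
  simp_rw [smul_add]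
  exact intervalIntegral.integral_add
    ((intervalIntegrable_iff_integrableOn_Ioc_of_le hT).2 hf)
    ((intervalIntegrable_iff_integrableOn_Ioc_of_le hT).2 hh)

lemma rlIntegral_continuousLinearMap [CompleteSpace E] {a T : ℝ} (hT : 0 ≤ T) {f : ℝ → E}
    (hf : IntegrableOn (fun s => rlKernel a (T - s) • f s) (Ioc 0 T)) (M : E →L[ℝ] E) :
    rlIntegral a (fun s => M (f s)) T = M (rlIntegral a f T) := by
  unfold rlIntegral
  rw [← ContinuousLinearMap.intervalIntegral_comp_comm _
    ((intervalIntegrable_iff_integrableOn_Ioc_of_le hT).2 hf)]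
  simp

lemma rlIntegral_one {h : ℝ → E} {t : ℝ} : rlIntegral 1 h t = ∫ s in (0 : ℝ)..t, h s := by
  simp [rlIntegral, rlKernel_one]

/-! ### Absolutely continuous curves and the Caputo derivative -/

lemma absolutelyContinuousOnInterval_continuousLinearMap_comp {F : Type*} [NormedAddCommGroup F]
    [NormedSpace ℝ F]
    {y : ℝ → E} {a b : ℝ} (hy : AbsolutelyContinuousOnInterval y a b) (L : E →L[ℝ] F) :
    AbsolutelyContinuousOnInterval (fun t => L (y t)) a b := by
  have h := Tendsto.const_mul ‖L‖ hy
  rw [mul_zero] at h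
  refine squeeze_zero (fun t => Finset.sum_nonneg fun i _ => dist_nonneg) (fun t => ?_) h
  rw [Finset.mul_sum]
  refine Finset.sum_le_sum fun i _ => ?_
  rw [dist_eq_norm, dist_eq_norm, ← map_sub]
  exact L.le_opNorm _

/-- The fundamental theorem of calculus for absolutely continuous curves in a finite-dimensional
space, reduced to real-valued functions through the coordinates of a basis. -/
theorem integral_deriv_of_absolutelyContinuous [FiniteDimensional ℝ E] {y : ℝ → E} {a b : ℝ}
    (hy : AbsolutelyContinuousOnInterval y a b) :
    IntervalIntegrable (deriv y) volume a b ∧ ∫ t in a..b, deriv y t = y b - y a := by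
  let B := Module.finBasis ℝ E
  let c : Fin (Module.finrank ℝ E) → E →L[ℝ] ℝ := fun i =>
    LinearMap.toContinuousLinearMap (B.coord i)
  have hc : ∀ v : E, ∑ i, c i v • B i = v := fun v => B.sum_repr v
  have hac := fun i => absolutelyContinuousOnInterval_continuousLinearMap_comp hy (c i)
  have hci : ∀ i, IntervalIntegrable (fun t => deriv (fun t => c i (y t)) t • B i) volume a b :=
    fun i => ⟨(hac i).intervalIntegrable_deriv.1.smul_const _,
      (hac i).intervalIntegrable_deriv.2.smul_const _⟩
  have hd : ∀ᵐ t, t ∈ uIoc a b → ∑ i, deriv (fun t => c i (y t)) t • B i = deriv y t := by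
    have hall : ∀ᵐ t, ∀ i, t ∈ uIcc a b → DifferentiableAt ℝ (fun t => c i (y t)) t :=
      ae_all_iff.2 fun i => (hac i).ae_differentiableAt
    filter_upwards [hall] with t ht hmem
    have h1 : HasDerivAt (fun t => ∑ i, c i (y t) • B i)
        (∑ i, deriv (fun t => c i (y t)) t • B i) t :=
      HasDerivAt.fun_sum fun i _ =>
        ((ht i (uIoc_subset_uIcc hmem)).hasDerivAt).smul_const (B i)
    simp_rw [hc] at h1
    exact h1.deriv.symm
  have hint : IntervalIntegrable (fun t => ∑ i, deriv (fun t => c i (y t)) t • B i) volume a b := by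
    refine (IntervalIntegrable.sum (f := fun i t => deriv (fun t => c i (y t)) t • B i)
      Finset.univ fun i _ => ?_).congr ?_
    · exact hci i
    · intro t _; simp
  constructor
  · refine hint.congr_ae ?_
    exact (ae_restrict_iff' measurableSet_uIoc).2 hd
  · rw [← intervalIntegral.integral_congr_ae hd, intervalIntegral.integral_finsetSum]
    · have e : ∀ i, ∫ t in a..b, deriv (fun t => c i (y t)) t • B i
          = (c i (y b) - c i (y a)) • B i := fun i => by
        rw [intervalIntegral.integral_smul_const, (hac i).integral_deriv_eq_sub]
      simp_rw [e, sub_smul, Finset.sum_sub_distrib, hc]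
    · exact fun i _ => hci i

/-- Taylor's formula with integral remainder for a chain of functions in which each is a primitive of
the next; `y n` need only be integrable. -/
theorem taylor_rlIntegral [CompleteSpace E] {y : ℕ → ℝ → E} {n : ℕ} (hn : 1 ≤ n)
    (hy : ∀ j < n, ∀ t, 0 ≤ t → y j t = y j 0 + ∫ s in (0 : ℝ)..t, y (j + 1) s)
    (hi : ∀ j ≤ n, ∀ T, 0 ≤ T → IntegrableOn (y j) (Ioc 0 T)) {t : ℝ} (ht : 0 ≤ t) :
    y 0 t = ∑ j ∈ Finset.range n, rlKernel (j + 1) t • y j 0 + rlIntegral n (y n) t := by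
  induction n, hn using Nat.le_induction with
  | base => simpa [rlKernel_one, rlIntegral_one] using hy 0 one_pos t ht
  | succ n hn ih =>
    have hn' : (1 : ℝ) ≤ n := by exact_mod_cast hn
    have hn0 : (0 : ℝ) < n := by linarith
    rw [ih (fun j hj => hy j (by omega)) (fun j hj => hi j (by omega)), Finset.sum_range_succ,
      add_assoc]
    congr 1
    have hi1 := hi (n + 1) le_rfl t ht
    have hk1 : IntegrableOn (fun s => rlKernel ((n : ℝ) + 1) (t - s) • y (n + 1) s) (Ioc 0 t) :=
      integrableOn_rlKernel_smul_of_one_le (by linarith) hi1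
    have e : rlIntegral n (y n) t = rlIntegral n
        (fun s => rlKernel 1 s • y n 0 + rlIntegral 1 (y (n + 1)) s) t := by
      refine rlIntegral_congr ht (ae_restrict_of_forall_mem measurableSet_Ioc fun s hs => ?_)
      simpa [rlKernel_one, rlIntegral_one] using hy n (by omega) s hs.1.le
    rw [e, rlIntegral_add ht, rlIntegral_rlKernel hn0 le_rfl ht,
      rlIntegral_rlIntegral hn0 one_pos ht hi1.1 hk1]
    · push_cast; rfl
    · simp only [rlKernel_one, one_smul]
      exact (integrableOn_rlKernel_sub hn0).smul_const _
    · exact integrableOn_rlKernel_smul_rlIntegral hn0 one_pos hi1.1 hk1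

lemma one_le_order {α : ℝ} (hα : 0 < α) : 1 ≤ order α := Nat.ceil_pos.2 hα

lemma le_order (α : ℝ) : α ≤ order α := Nat.le_ceil α

namespace CaputoRegular

variable {α : ℝ} {x : ℝ → E}

lemma continuousOn_dtime (hx : CaputoRegular α x) {j : ℕ} (hj : j < order α) :
    ContinuousOn (dtime j x) (Ici 0) :=
  hx.1.continuousOn_iteratedDerivWithin (by exact_mod_cast (by omega : j ≤ order α - 1))
    (uniqueDiffOn_Ici 0)

lemma continuousOn (hα : 0 < α) (hx : CaputoRegular α x) : ContinuousOn x (Ici 0) := by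
  simpa [dtime] using hx.continuousOn_dtime (one_le_order hα)

/-- Each derivative of order below `order α` is the integral of the next one: below the top order
by continuity, at the top order by absolute continuity. -/
lemma integrable_dtime_and_ftc [FiniteDimensional ℝ E] (hx : CaputoRegular α x) {j : ℕ}
    (hj : j < order α) {T : ℝ} (hT : 0 ≤ T) :
    IntegrableOn (dtime (j + 1) x) (Ioc 0 T) ∧
      dtime j x T = dtime j x 0 + ∫ s in (0 : ℝ)..T, dtime (j + 1) x s := by
  have hsucc : dtime (j + 1) x = derivWithin (dtime j x) (Ici 0) := iteratedDerivWithin_succ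
  have hder : ∀ s : ℝ, 0 < s → derivWithin (dtime j x) (Ici 0) s = deriv (dtime j x) s :=
    fun s hs => derivWithin_of_mem_nhds (Ici_mem_nhds hs)
  suffices h : IntervalIntegrable (dtime (j + 1) x) volume 0 T ∧
      ∫ s in (0 : ℝ)..T, dtime (j + 1) x s = dtime j x T - dtime j x 0 by
    refine ⟨(intervalIntegrable_iff_integrableOn_Ioc_of_le hT).1 h.1, ?_⟩
    rw [h.2]; abel
  rcases (by omega : j + 1 < order α ∨ j = order α - 1) with hj' | rfl
  · have hint : IntervalIntegrable (dtime (j + 1) x) volume 0 T := by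
      refine ContinuousOn.intervalIntegrable ?_
      rw [uIcc_of_le hT]
      exact (hx.continuousOn_dtime hj').mono Icc_subset_Ici_self
    refine ⟨hint, intervalIntegral.integral_eq_sub_of_hasDerivAt_of_le hT
      ((hx.continuousOn_dtime hj).mono Icc_subset_Ici_self) (fun s hs => ?_) hint⟩
    have hdiff : DifferentiableOn ℝ (dtime j x) (Ici 0) :=
      hx.1.differentiableOn_iteratedDerivWithin
        (by exact_mod_cast (by omega : j < order α - 1)) (uniqueDiffOn_Ici 0)
    rw [hsucc, hder s hs.1]
    exact (hdiff.differentiableAt (Ici_mem_nhds hs.1)).hasDerivAt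
  · have hac := integral_deriv_of_absolutelyContinuous (hx.2 T hT)
    have heq : ∀ s ∈ uIoc 0 T, deriv (dtime (order α - 1) x) s
        = dtime (order α - 1 + 1) x s := by
      intro s hs
      rw [uIoc_of_le hT] at hs
      rw [hsucc, hder s hs.1]
    refine ⟨hac.1.congr heq, ?_⟩
    rw [← hac.2]
    exact (intervalIntegral.integral_congr_ae (ae_of_all _ heq)).symm

lemma integrableOn_dtime [FiniteDimensional ℝ E] (hα : 0 < α) (hx : CaputoRegular α x) {j : ℕ}
    (hj : j ≤ order α) {T : ℝ} (hT : 0 ≤ T) : IntegrableOn (dtime j x) (Ioc 0 T) := by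
  rcases j with _ | j
  · exact (((hx.continuousOn_dtime (one_le_order hα)).mono
      Icc_subset_Ici_self).integrableOn_Icc).mono_set Ioc_subset_Icc_self
  · exact (hx.integrable_dtime_and_ftc (by omega) hT).1

end CaputoRegular

/-- For non-integer `α` the Caputo derivative is the fractional integral of order `⌈α⌉ - α` of the
derivative of order `⌈α⌉`. -/
lemma caputoDeriv_eq_rlIntegral {α : ℝ} (hα : α ≠ order α) (x : ℝ → E) {t : ℝ} (ht : 0 ≤ t) :
    caputoDeriv α x t = rlIntegral (order α - α) (dtime (order α) x) t := by
  rw [caputoDeriv, if_neg hα, rlIntegral, ← intervalIntegral.integral_smul]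
  refine intervalIntegral.integral_congr fun τ hτ => ?_
  rw [uIcc_of_le ht] at hτ
  have h0 : 0 ≤ t - τ := by linarith [hτ.2]
  simp only [smul_smul]
  congr 1
  rw [rlKernel, show (order α : ℝ) - α - 1 = -(α + 1 - order α) by ring, Real.rpow_neg h0]
  ring

theorem aestronglyMeasurable_caputoDeriv [FiniteDimensional ℝ E] {α : ℝ} (hα : 0 < α) {x : ℝ → E}
    (hx : CaputoRegular α x) {T : ℝ} (hT : 0 ≤ T) :
    AEStronglyMeasurable (caputoDeriv α x) (volume.restrict (Ioc 0 T)) := by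
  have hi := hx.integrableOn_dtime hα le_rfl hT
  by_cases h : α = order α
  · have : caputoDeriv α x = dtime (order α) x := by ext t; rw [caputoDeriv, if_pos h]
    rw [this]; exact hi.1
  · have hb : 0 < (order α : ℝ) - α := sub_pos.2 (lt_of_le_of_ne (le_order α) h)
    have h1 := integrableOn_rlKernel_smul_rlIntegral one_pos hb hi.1
      (integrableOn_rlKernel_smul_of_one_le (by linarith) hi)
    refine h1.1.congr (ae_restrict_of_forall_mem measurableSet_Ioc fun t ht => ?_)
    simp only [rlKernel_one, one_smul]
    exact (caputoDeriv_eq_rlIntegral h x ht.1.le).symm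

/-- The fractional integral of order `α` inverts the Caputo derivative up to the Taylor polynomial
of the initial data. -/
theorem eq_taylor_add_rlIntegral_caputoDeriv [FiniteDimensional ℝ E] {α : ℝ} (hα : 0 < α)
    {x : ℝ → E} (hx : CaputoRegular α x) {t : ℝ} (ht : 0 ≤ t) :
    x t = ∑ j ∈ Finset.range (order α), rlKernel (j + 1) t • dtime j x 0
      + rlIntegral α (caputoDeriv α x) t := by
  have h0 : x t = dtime 0 x t := by simp [dtime]
  have hi := hx.integrableOn_dtime hα le_rfl ht
  rw [h0, taylor_rlIntegral (y := fun j => dtime j x) (one_le_order hα)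
    (fun j hj s hs => (hx.integrable_dtime_and_ftc hj hs).2)
    (fun j hj s hs => hx.integrableOn_dtime hα hj hs) ht]
  congr 1
  by_cases h : α = order α
  · have : caputoDeriv α x = dtime (order α) x := by ext t; rw [caputoDeriv, if_pos h]
    rw [this, ← h]
  · have hb : 0 < (order α : ℝ) - α := sub_pos.2 (lt_of_le_of_ne (le_order α) h)
    have hk : (1 : ℝ) ≤ order α := by exact_mod_cast one_le_order hα
    rw [rlIntegral_congr (a := α) ht (ae_restrict_of_forall_mem measurableSet_Ioc
      fun s hs => caputoDeriv_eq_rlIntegral h x hs.1.le),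
      rlIntegral_rlIntegral hα hb ht hi.1
        (integrableOn_rlKernel_smul_of_one_le (by linarith) hi)]
    rw [add_sub_cancel]

/-! ### Mittag-Leffler series and the Volterra equation -/

/-- Stated for all `l`, including `l = 0` on the zero space, where the identity has norm `0`. -/
lemma norm_clm_pow_le (M : E →L[ℝ] E) (l : ℕ) : ‖M ^ l‖ ≤ ‖M‖ ^ l := by
  rcases l.eq_zero_or_pos with rfl | hl
  · rw [pow_zero, pow_zero]
    exact ContinuousLinearMap.norm_id_le
  · exact norm_pow_le' M hl

lemma norm_rlKernel_smul_pow_le {α β t : ℝ} (hα : 0 < α) (hβ : 0 < β) (ht : 0 ≤ t)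
    (M : E →L[ℝ] E) (l : ℕ) :
    ‖rlKernel (α * l + β) t • M ^ l‖ ≤ ‖M‖ ^ l * rlKernel (α * l + β) t := by
  have := rlKernel_nonneg (by positivity : 0 < α * l + β) ht
  rw [norm_smul, Real.norm_of_nonneg this, mul_comm]
  gcongr
  exact norm_clm_pow_le M l

lemma summable_rlKernel_smul_pow [CompleteSpace E] {α β t : ℝ} (hα : 0 < α) (hβ : 0 < β)
    (ht : 0 ≤ t) (M : E →L[ℝ] E) : Summable fun l : ℕ => rlKernel (α * l + β) t • M ^ l :=
  Summable.of_norm_bounded (summable_pow_mul_rlKernel (β := β) hα (norm_nonneg M) ht)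
    fun l => norm_rlKernel_smul_pow_le hα hβ ht M l

theorem hasSum_PhiJ [CompleteSpace E] {α t : ℝ} (hα : 0 < α) (ht : 0 ≤ t) (M : E →L[ℝ] E)
    (j : ℕ) : HasSum (fun l : ℕ => rlKernel (α * l + (j + 1)) t • M ^ l) (PhiJ α M j t) := by
  have h := (summable_rlKernel_smul_pow hα (by positivity : (0 : ℝ) < j + 1) ht M).hasSum
  convert h using 1
  rw [PhiJ, mittagLeffler, ← tsum_const_smul'']
  congr 1 with l : 1
  rw [smul_pow, smul_smul, smul_smul]
  congr 1
  rw [rlKernel, show α * l + ((j : ℝ) + 1) - 1 = α * l + j by ring,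
    Real.rpow_add_of_nonneg ht (by positivity) (by positivity), Real.rpow_mul ht,
    Real.rpow_natCast, Real.rpow_natCast]
  ring

theorem hasSum_Phi [CompleteSpace E] {α t : ℝ} (hα : 0 < α) (ht : 0 < t) (M : E →L[ℝ] E) :
    HasSum (fun l : ℕ => rlKernel (α * l + α) t • M ^ l) (Phi α M t) := by
  have h := (summable_rlKernel_smul_pow hα hα ht.le M).hasSum
  convert h using 1
  rw [Phi, mittagLeffler, ← tsum_const_smul'']
  congr 1 with l : 1
  rw [smul_pow, smul_smul, smul_smul]
  congr 1
  rw [rlKernel, show α * l + α - 1 = α * l + (α - 1) by ring,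
    Real.rpow_add ht, Real.rpow_mul ht.le, Real.rpow_natCast]
  ring

lemma rlIntegral_finsetSum {ι : Type*} (u : Finset ι) {a T : ℝ} (hT : 0 ≤ T) {f : ι → ℝ → E}
    (hf : ∀ i ∈ u, IntegrableOn (fun s => rlKernel a (T - s) • f i s) (Ioc 0 T)) :
    rlIntegral a (fun s => ∑ i ∈ u, f i s) T = ∑ i ∈ u, rlIntegral a (f i) T := by
  unfold rlIntegral
  simp_rw [Finset.smul_sum]
  exact intervalIntegral.integral_finsetSum fun i hi =>
    (intervalIntegrable_iff_integrableOn_Ioc_of_le hT).2 (hf i hi)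

/-- Termwise integration of the Mittag-Leffler series in the convolution of `Phi` with a bounded
function. -/
theorem hasSum_pow_rlIntegral [CompleteSpace E] {α t C : ℝ} (hα : 0 < α) (ht : 0 ≤ t)
    (M : E →L[ℝ] E) {f : ℝ → E} (hm : AEStronglyMeasurable f (volume.restrict (Ioc 0 t)))
    (hC : ∀ᵐ s ∂volume.restrict (Ioc 0 t), ‖f s‖ ≤ C) :
    HasSum (fun l : ℕ => (M ^ l) (rlIntegral (α * l + α) f t))
      (∫ s in (0 : ℝ)..t, Phi α M (t - s) (f s)) := by
  have hpos : ∀ l : ℕ, 0 < α * l + α := fun l => by positivity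
  have hint : ∀ l : ℕ,
      IntegrableOn (fun s => rlKernel (α * l + α) (t - s) • f s) (Ioc 0 t) :=
    fun l => integrableOn_rlKernel_smul_of_bounded (hpos l) hm hC
  have hF : ∀ l : ℕ, Integrable (fun s => (M ^ l) (rlKernel (α * l + α) (t - s) • f s))
      (volume.restrict (Ioc 0 t)) := fun l => (M ^ l).integrable_comp (hint l)
  have hle : ∀ l : ℕ, ∫ s in Ioc 0 t, ‖(M ^ l) (rlKernel (α * l + α) (t - s) • f s)‖
      ≤ ‖M‖ ^ l * rlKernel (α * l + (α + 1)) t * C := by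
    intro l
    have e : ‖M‖ ^ l * rlKernel (α * l + (α + 1)) t * C
        = ∫ s in Ioc 0 t, ‖M‖ ^ l * (rlKernel (α * l + α) (t - s) * C) := by
      rw [integral_const_mul, integral_mul_const, ← intervalIntegral.integral_of_le ht,
        integral_rlKernel_sub (hpos l) ht, add_assoc, mul_assoc]
    rw [e]
    refine integral_mono_ae (hF l).norm
      (((integrableOn_rlKernel_sub (t := t) (hpos l)).mul_const C).const_mul _) ?_
    filter_upwards [hC, ae_restrict_mem measurableSet_Ioc] with s hs hst
    have h0 := rlKernel_nonneg (hpos l) (by linarith [hst.2] : 0 ≤ t - s)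
    calc _ ≤ ‖M ^ l‖ * ‖rlKernel (α * l + α) (t - s) • f s‖ := (M ^ l).le_opNorm _
      _ ≤ _ := by
        rw [norm_smul, Real.norm_of_nonneg h0]
        gcongr
        exact norm_clm_pow_le M l
  have hsum := hasSum_integral_of_summable_integral_norm hF
    (Summable.of_nonneg_of_le (fun l => integral_nonneg fun s => norm_nonneg _) hle
      ((summable_pow_mul_rlKernel hα (norm_nonneg M) ht).mul_right C))
  convert hsum using 1
  · ext l
    rw [rlIntegral, intervalIntegral.integral_of_le ht, ContinuousLinearMap.integral_comp_comm _
      (hint l)]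
  · rw [intervalIntegral.integral_of_le ht]
    refine integral_congr_ae ?_
    filter_upwards [ae_restrict_mem measurableSet_Ioc, ae_restrict_of_ae (Measure.ae_ne volume t)]
      with s hs hst
    have h := (hasSum_Phi hα (sub_pos.2 (lt_of_le_of_ne hs.2 hst)) M).mapL
      (ContinuousLinearMap.apply ℝ E (f s))
    rw [← ContinuousLinearMap.apply_apply (f s), ← h.tsum_eq]
    simp

section Volterra

variable [CompleteSpace E] {α : ℝ} {k : ℕ} {M : E →L[ℝ] E} {x f : ℝ → E} {v : ℕ → E}

/-- One substitution of the Volterra equation into a fractional integral of its solution. -/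
lemma rlIntegral_volterra (hα : 0 < α) {b t C : ℝ} (hb : 0 < b) (ht : 0 ≤ t)
    (hx : ContinuousOn x (Ici 0)) (hm : AEStronglyMeasurable f (volume.restrict (Ioc 0 t)))
    (hC : ∀ᵐ s ∂volume.restrict (Ioc 0 t), ‖f s‖ ≤ C)
    (heq : ∀ s, 0 ≤ s → x s = ∑ j ∈ Finset.range k, rlKernel (j + 1) s • v j
      + rlIntegral α f s + M (rlIntegral α x s)) :
    rlIntegral b x t = ∑ j ∈ Finset.range k, rlKernel (b + (j + 1)) t • v j
      + rlIntegral (b + α) f t + M (rlIntegral (b + α) x t) := by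
  have hxc : ContinuousOn x (Icc 0 t) := hx.mono Icc_subset_Ici_self
  have hxm : AEStronglyMeasurable x (volume.restrict (Ioc 0 t)) :=
    (hxc.mono Ioc_subset_Icc_self).aestronglyMeasurable measurableSet_Ioc
  obtain ⟨X, hX⟩ := isCompact_Icc.exists_bound_of_continuousOn hxc
  have hX' : ∀ᵐ s ∂volume.restrict (Ioc 0 t), ‖x s‖ ≤ X :=
    ae_restrict_of_forall_mem measurableSet_Ioc fun s hs => hX s (Ioc_subset_Icc_self hs)
  have hfi := integrableOn_rlKernel_smul_of_bounded (add_pos hb hα) hm hC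
  have hxi := integrableOn_rlKernel_smul_of_bounded (add_pos hb hα) hxm hX'
  have hpi : ∀ j ∈ Finset.range k,
      IntegrableOn (fun s => rlKernel b (t - s) • rlKernel ((j : ℝ) + 1) s • v j) (Ioc 0 t) := by
    intro j _
    refine integrableOn_rlKernel_smul_of_bounded (C := rlKernel ((j : ℝ) + 1) t * ‖v j‖) hb
      ((measurable_rlKernel _).aestronglyMeasurable.smul_const _)
      (ae_restrict_of_forall_mem measurableSet_Ioc fun s hs => ?_)
    rw [norm_smul, Real.norm_of_nonneg (rlKernel_nonneg (by positivity) hs.1.le)]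
    gcongr
    exact rlKernel_mono (by linarith [j.cast_nonneg (α := ℝ)]) hs.1.le hs.2
  have hpi' : IntegrableOn (fun s => rlKernel b (t - s) •
      ∑ j ∈ Finset.range k, rlKernel ((j : ℝ) + 1) s • v j) (Ioc 0 t) := by
    simp_rw [Finset.smul_sum]
    exact integrable_finsetSum _ hpi
  have hff := integrableOn_rlKernel_smul_rlIntegral hb hα hm hfi
  have hxx := integrableOn_rlKernel_smul_rlIntegral hb hα hxm hxi
  have hMx : IntegrableOn (fun s => rlKernel b (t - s) • M (rlIntegral α x s)) (Ioc 0 t) := by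
    simpa [IntegrableOn] using M.integrable_comp hxx
  rw [rlIntegral_congr ht (ae_restrict_of_forall_mem measurableSet_Ioc
    fun s hs => heq s hs.1.le), rlIntegral_add ht _ hMx, rlIntegral_add ht hpi' hff,
    rlIntegral_finsetSum _ ht hpi, rlIntegral_continuousLinearMap ht hxx,
    rlIntegral_rlIntegral hb hα ht hm hfi,
    rlIntegral_rlIntegral hb hα ht hxm hxi]
  · congr 2
    refine Finset.sum_congr rfl fun j _ => ?_
    exact rlIntegral_rlKernel hb (by linarith [j.cast_nonneg (α := ℝ)]) ht _
  · simp_rw [smul_add]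
    exact hpi'.add hff

/-- The Volterra equation substituted `N` times into itself. -/
lemma volterra_iterate (hα : 0 < α) {t C : ℝ} (ht : 0 ≤ t)
    (hx : ContinuousOn x (Ici 0)) (hm : AEStronglyMeasurable f (volume.restrict (Ioc 0 t)))
    (hC : ∀ᵐ s ∂volume.restrict (Ioc 0 t), ‖f s‖ ≤ C)
    (heq : ∀ s, 0 ≤ s → x s = ∑ j ∈ Finset.range k, rlKernel (j + 1) s • v j
      + rlIntegral α f s + M (rlIntegral α x s)) (N : ℕ) :
    x t = ∑ l ∈ Finset.range (N + 1), (M ^ l)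
        (∑ j ∈ Finset.range k, rlKernel (α * l + (j + 1)) t • v j + rlIntegral (α * l + α) f t)
      + (M ^ (N + 1)) (rlIntegral (α * N + α) x t) := by
  induction N with
  | zero => simpa using heq t ht
  | succ N ih =>
    rw [ih, Finset.sum_range_succ _ (N + 1), add_assoc (∑ l ∈ Finset.range (N + 1), _)]
    congr 1
    rw [rlIntegral_volterra hα (by positivity : 0 < α * N + α) ht hx hm hC heq, map_add,
      pow_succ M (N + 1)]
    have e : α * ((N + 1 : ℕ) : ℝ) = α * N + α := by push_cast; ring
    rw [e]
    rfl

/-- Variation of constants: the solution of the Volterra equation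
`x = ∑ⱼ tʲ / j! vⱼ + J^α f + M J^α x` is given by the Mittag-Leffler functions. The remainder of the
iterated equation vanishes in the limit as it is a term of a convergent series. -/
theorem eq_PhiJ_add_integral_Phi (hα : 0 < α) {t C : ℝ} (ht : 0 ≤ t)
    (hx : ContinuousOn x (Ici 0)) (hm : AEStronglyMeasurable f (volume.restrict (Ioc 0 t)))
    (hC : ∀ᵐ s ∂volume.restrict (Ioc 0 t), ‖f s‖ ≤ C)
    (heq : ∀ s, 0 ≤ s → x s = ∑ j ∈ Finset.range k, rlKernel (j + 1) s • v j
      + rlIntegral α f s + M (rlIntegral α x s)) :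
    x t = ∑ j ∈ Finset.range k, PhiJ α M j t (v j)
      + ∫ s in (0 : ℝ)..t, Phi α M (t - s) (f s) := by
  have h1 : HasSum (fun l : ℕ => ∑ j ∈ Finset.range k,
      (rlKernel (α * l + (j + 1)) t • M ^ l) (v j)) (∑ j ∈ Finset.range k, PhiJ α M j t (v j)) :=
    hasSum_sum fun j _ => (hasSum_PhiJ hα ht M j).mapL (ContinuousLinearMap.apply ℝ E (v j))
  have h2 := (h1.add (hasSum_pow_rlIntegral hα ht M hm hC)).tendsto_sum_nat.comp
    (tendsto_add_atTop_nat 1)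
  obtain ⟨X, hX⟩ := isCompact_Icc.exists_bound_of_continuousOn 
    (hx.mono (Icc_subset_Ici_self : Icc 0 t ⊆ Ici 0))
  have hX' : ∀ᵐ s ∂volume.restrict (Ioc 0 t), ‖x s‖ ≤ X :=
    ae_restrict_of_forall_mem measurableSet_Ioc fun s hs => hX s (Ioc_subset_Icc_self hs)
  have h3 : Tendsto (fun N : ℕ => (M ^ (N + 1)) (rlIntegral (α * N + α) x t)) atTop (𝓝 0) := by
    have hs := (summable_pow_mul_rlKernel (β := 1) hα (norm_nonneg M) ht).tendsto_atTop_zero.comp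
      (tendsto_add_atTop_nat 1)
    have hs' := hs.mul_const X
    rw [zero_mul] at hs'
    refine squeeze_zero_norm (fun N => ?_) hs'
    have hb := norm_rlIntegral_le (by positivity : 0 < α * N + α) ht hX'
    calc _ ≤ ‖M ^ (N + 1)‖ * ‖rlIntegral (α * N + α) x t‖ := (M ^ (N + 1)).le_opNorm _
      _ ≤ ‖M‖ ^ (N + 1) * (rlKernel (α * N + α + 1) t * X) := by
        gcongr
        exact norm_clm_pow_le M _
      _ = _ := by
        simp only [Function.comp_apply]
        push_cast
        ring_nf
  have h4 := h2.add h3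
  rw [add_zero] at h4
  refine tendsto_nhds_unique (tendsto_const_nhds.congr fun N => ?_) h4
  rw [volterra_iterate hα ht hx hm hC heq N]
  congr 1
  refine Finset.sum_congr rfl fun l _ => ?_
  simp [map_add, map_sum]

end Volterra

end FractionalIntegral

/-! ### Estimates for perturbed linear Caputo equations -/

section Estimate

variable {E : Type*} [NormedAddCommGroup E] [NormedSpace ℝ E]
  {α c K0 K1 : ℝ} {M : E →L[ℝ] E} {K0j : ℕ → ℝ → ℝ} {x : ℝ → E}

/-- Variation of constants for `D^α x = M x + f`, where the perturbation `f` is defined as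
`D^α x - M x`. It is thereby measurable, whatever the feedback gains are. -/
theorem CaputoRegular.eq_PhiJ_add_integral_Phi [FiniteDimensional ℝ E] (hα : 0 < α)
    (hx : CaputoRegular α x)
    (hp : ∀ᵐ t ∂volume.restrict (Ioi (0 : ℝ)), ‖caputoDeriv α x t - M (x t)‖ ≤ c * ‖x t‖)
    (hc : 0 ≤ c) {t : ℝ} (ht : 0 ≤ t) :
    x t = ∑ j ∈ Finset.range (order α), PhiJ α M j t (dtime j x 0)
      + ∫ s in (0 : ℝ)..t, Phi α M (t - s) (caputoDeriv α x s - M (x s)) := by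
  have hcont := hx.continuousOn hα
  have hxm : ∀ T, AEStronglyMeasurable x (volume.restrict (Ioc 0 T)) := fun T =>
    (hcont.mono (Ioc_subset_Ioi_self.trans Ioi_subset_Ici_self)).aestronglyMeasurable
      measurableSet_Ioc
  have hbound : ∀ T, ∃ X, ∀ s ∈ Ioc 0 T, ‖x s‖ ≤ X := fun T => by
    obtain ⟨X, hX⟩ := isCompact_Icc.exists_bound_of_continuousOn
      (hcont.mono (Icc_subset_Ici_self : Icc 0 T ⊆ Ici 0))
    exact ⟨X, fun s hs => hX s (Ioc_subset_Icc_self hs)⟩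
  have hfm : ∀ T, 0 ≤ T → AEStronglyMeasurable (fun s => caputoDeriv α x s - M (x s))
      (volume.restrict (Ioc 0 T)) := fun T hT =>
    (aestronglyMeasurable_caputoDeriv hα hx hT).sub (M.continuous.comp_aestronglyMeasurable (hxm T))
  have hfb : ∀ T, ∃ C, ∀ᵐ s ∂volume.restrict (Ioc 0 T), ‖caputoDeriv α x s - M (x s)‖ ≤ C := by
    intro T
    obtain ⟨X, hX⟩ := hbound T
    refine ⟨c * X, ?_⟩
    filter_upwards [ae_restrict_of_ae_restrict_of_subset Ioc_subset_Ioi_self hp,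
      ae_restrict_mem measurableSet_Ioc] with s hs hsT
    exact hs.trans (by gcongr; exact hX s hsT)
  obtain ⟨C, hC⟩ := hfb t
  refine CaputoSystem.eq_PhiJ_add_integral_Phi hα ht hcont (hfm t ht) hC fun s hs => ?_
  obtain ⟨C', hC'⟩ := hfb s
  obtain ⟨X, hX⟩ := hbound s
  have hfi := integrableOn_rlKernel_smul_of_bounded hα (hfm s hs) hC'
  have hxi := integrableOn_rlKernel_smul_of_bounded hα (hxm s)
    (ae_restrict_of_forall_mem measurableSet_Ioc hX)
  have hMx : IntegrableOn (fun τ => rlKernel α (s - τ) • M (x τ)) (Ioc 0 s) := by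
    simpa [IntegrableOn] using M.integrable_comp hxi
  rw [add_assoc, ← rlIntegral_continuousLinearMap hs hxi, ← rlIntegral_add hs hfi hMx]
  simpa using eq_taylor_add_rlIntegral_caputoDeriv hα hx hs

lemma PhiBounds.intervalIntegrable (hΦ : PhiBounds α M K0j K0 K1) {t : ℝ} (ht : 0 ≤ t) :
    IntervalIntegrable (fun s => ‖Phi α M (t - s)‖) volume 0 t := by
  have h : IntervalIntegrable (fun s => ‖Phi α M s‖) volume 0 t :=
    (intervalIntegrable_iff_integrableOn_Ioc_of_le ht).2
      (hΦ.2.1.mono_set Ioc_subset_Ioi_self).norm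
  simpa using (h.comp_sub_left t).symm

lemma PhiBounds.nonneg_left (hα : 0 < α) (hΦ : PhiBounds α M K0j K0 K1) : 0 ≤ K0 := by
  obtain ⟨h1, h2⟩ := hΦ.1 0 (one_le_order hα) 0 le_rfl
  exact (norm_nonneg _).trans (h1.trans h2)

lemma PhiBounds.nonneg_right (hΦ : PhiBounds α M K0j K0 K1) : 0 ≤ K1 := by
  simpa using hΦ.2.2 0 le_rfl

lemma intervalIntegrable_norm_Phi_mul (hα : 0 < α) (hΦ : PhiBounds α M K0j K0 K1)
    (hx : CaputoRegular α x) {t : ℝ} (ht : 0 ≤ t) :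
    IntervalIntegrable (fun s => ‖Phi α M (t - s)‖ * ‖x s‖) volume 0 t := by
  refine (hΦ.intervalIntegrable ht).mul_continuousOn ?_
  rw [uIcc_of_le ht]
  exact ((hx.continuousOn hα).mono Icc_subset_Ici_self).norm

theorem CaputoRegular.norm_le_integral [FiniteDimensional ℝ E] (hα : 0 < α)
    (hΦ : PhiBounds α M K0j K0 K1)
    (hx : CaputoRegular α x)
    (hp : ∀ᵐ t ∂volume.restrict (Ioi (0 : ℝ)), ‖caputoDeriv α x t - M (x t)‖ ≤ c * ‖x t‖)
    (hc : 0 ≤ c) {t : ℝ} (ht : 0 ≤ t) :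
    ‖x t‖ ≤ ∑ j ∈ Finset.range (order α), K0j j t * ‖dtime j x 0‖
      + c * ∫ s in (0 : ℝ)..t, ‖Phi α M (t - s)‖ * ‖x s‖ := by
  conv_lhs => rw [hx.eq_PhiJ_add_integral_Phi hα hp hc ht]
  refine (norm_add_le _ _).trans (add_le_add ?_ ?_)
  · refine (norm_sum_le _ _).trans (Finset.sum_le_sum fun j hj => ?_)
    refine ((PhiJ α M j t).le_opNorm _).trans ?_
    gcongr
    exact (hΦ.1 j (Finset.mem_range.1 hj) t ht).1
  · rw [← intervalIntegral.integral_const_mul]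
    refine intervalIntegral.norm_integral_le_of_norm_le ht ?_
      ((intervalIntegrable_norm_Phi_mul hα hΦ hx ht).const_mul c)
    have h := (ae_restrict_iff' measurableSet_Ioi).1 hp
    filter_upwards [h] with s hs hst
    refine ((Phi α M (t - s)).le_opNorm _).trans ?_
    calc _ ≤ ‖Phi α M (t - s)‖ * (c * ‖x s‖) := by gcongr; exact hs hst.1
      _ = _ := by ring

/-- Uniform bound on a trajectory in terms of its initial data, obtained by evaluating
`CaputoRegular.norm_le_integral` where `‖x‖` is maximal on `[0, t]`. -/
theorem CaputoRegular.norm_le_of_norm_dtime_le [FiniteDimensional ℝ E] (hα : 0 < α)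
    (hΦ : PhiBounds α M K0j K0 K1)
    (hx : CaputoRegular α x)
    (hp : ∀ᵐ t ∂volume.restrict (Ioi (0 : ℝ)), ‖caputoDeriv α x t - M (x t)‖ ≤ c * ‖x t‖)
    (hc : 0 ≤ c) (hK : K1 * c < 1) {R : ℝ} (hR : ∀ j < order α, ‖dtime j x 0‖ ≤ R)
    {t : ℝ} (ht : 0 ≤ t) : ‖x t‖ ≤ order α * (K0 * R) / (1 - K1 * c) := by
  obtain ⟨m, hm, hmax⟩ := isCompact_Icc.exists_isMaxOn (nonempty_Icc.2 ht)
    ((hx.continuousOn hα).mono (Icc_subset_Ici_self : Icc 0 t ⊆ Ici 0)).norm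
  refine (hmax (right_mem_Icc.2 ht)).trans ?_
  rw [le_div_iff₀ (by linarith)]
  have h := hx.norm_le_integral hα hΦ hp hc hm.1
  have h1 : ∑ j ∈ Finset.range (order α), K0j j m * ‖dtime j x 0‖ ≤ order α * (K0 * R) := by
    rw [← nsmul_eq_mul]
    refine (Finset.sum_le_card_nsmul _ _ (K0 * R) fun j hj => ?_).trans (by simp)
    have hj' := Finset.mem_range.1 hj
    have hK0 := hΦ.nonneg_left hα
    have := (hΦ.1 j hj' m hm.1).2
    have := hR j hj'
    gcongr
  have h2 : ∫ s in (0 : ℝ)..m, ‖Phi α M (m - s)‖ * ‖x s‖ ≤ K1 * ‖x m‖ := by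
    calc _ ≤ ∫ s in (0 : ℝ)..m, ‖Phi α M (m - s)‖ * ‖x m‖ := by
          refine intervalIntegral.integral_mono_on hm.1
            (intervalIntegrable_norm_Phi_mul hα hΦ hx hm.1)
            ((hΦ.intervalIntegrable hm.1).mul_const _) fun s hs => ?_
          gcongr
          exact hmax ⟨hs.1, hs.2.trans hm.2⟩
      _ ≤ _ := by
        rw [intervalIntegral.integral_mul_const]
        gcongr
        exact hΦ.2.2 m hm.1
  have h3 := mul_le_mul_of_nonneg_left h2 hc
  simp only at *
  linarith

/-- The memory of a bounded initial time interval fades, because `Phi` is integrable. -/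
lemma tendsto_integral_norm_Phi (hΦ : PhiBounds α M K0j K0 K1) (T : ℝ) :
    Tendsto (fun t => ∫ s in (0 : ℝ)..T, ‖Phi α M (t - s)‖) atTop (𝓝 0) := by
  have hI : ∀ a b, 0 ≤ a → 0 ≤ b → IntervalIntegrable (fun s => ‖Phi α M s‖) volume a b := by
    intro a b ha hb
    rw [intervalIntegrable_iff]
    exact (hΦ.2.1.mono_set fun s hs => lt_of_le_of_lt (le_min ha hb) hs.1).norm
  have h1 := intervalIntegral_tendsto_integral_Ioi 0 hΦ.2.1.norm tendsto_id
  have h2 := intervalIntegral_tendsto_integral_Ioi 0 hΦ.2.1.norm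
    (tendsto_atTop_add_const_right atTop (-T) tendsto_id)
  have h3 := h1.sub h2
  rw [sub_self] at h3
  refine h3.congr' ?_
  filter_upwards [eventually_ge_atTop 0, eventually_ge_atTop T] with t ht htT
  rw [intervalIntegral.integral_comp_sub_left (fun s => ‖Phi α M s‖) t, sub_zero,
    ← intervalIntegral.integral_interval_sub_left (hI 0 t le_rfl ht)
      (hI 0 (t - T) le_rfl (by linarith))]
  rfl

/-- An eventual bound `L` improves to any number above `K1 * c * L`: the history before the bound
holds contributes a vanishing amount. -/
theorem CaputoRegular.eventually_norm_le [FiniteDimensional ℝ E] (hα : 0 < α)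
    (hΦ : PhiBounds α M K0j K0 K1)
    (hK0j : ∀ j < order α, Tendsto (K0j j) atTop (𝓝 0)) (hx : CaputoRegular α x)
    (hp : ∀ᵐ t ∂volume.restrict (Ioi (0 : ℝ)), ‖caputoDeriv α x t - M (x t)‖ ≤ c * ‖x t‖)
    (hc : 0 ≤ c) {C : ℝ} (hC : ∀ t, 0 ≤ t → ‖x t‖ ≤ C) {L : ℝ} (hL0 : 0 ≤ L)
    (hL : ∀ᶠ t in atTop, ‖x t‖ ≤ L) {ε : ℝ} (hε : 0 < ε) :
    ∀ᶠ t in atTop, ‖x t‖ ≤ K1 * c * L + ε := by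
  obtain ⟨T', hT'⟩ := eventually_atTop.1 hL
  obtain ⟨T, hT0, hT⟩ : ∃ T, 0 ≤ T ∧ ∀ s, T ≤ s → ‖x s‖ ≤ L :=
    ⟨max T' 0, le_max_right _ _, fun s hs => hT' s ((le_max_left _ _).trans hs)⟩
  have hsum : Tendsto (fun t => ∑ j ∈ Finset.range (order α), K0j j t * ‖dtime j x 0‖
      + c * (C * ∫ s in (0 : ℝ)..T, ‖Phi α M (t - s)‖)) atTop (𝓝 0) := by
    have h1 : Tendsto (fun t => ∑ j ∈ Finset.range (order α), K0j j t * ‖dtime j x 0‖) atTop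
        (𝓝 (∑ j ∈ Finset.range (order α), 0 * ‖dtime j x 0‖)) :=
      tendsto_finsetSum _ fun j hj => (hK0j j (Finset.mem_range.1 hj)).mul_const _
    simpa using h1.add (((tendsto_integral_norm_Phi hΦ T).const_mul C).const_mul c)
  filter_upwards [hsum.eventually_le_const hε, eventually_ge_atTop T] with t hle htT
  have ht : 0 ≤ t := hT0.trans htT
  have h := hx.norm_le_integral hα hΦ hp hc ht
  have hΦi := hΦ.intervalIntegrable ht
  have hi := intervalIntegrable_norm_Phi_mul hα hΦ hx ht
  have s1 : uIcc 0 T ⊆ uIcc 0 t := by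
    rw [uIcc_of_le hT0, uIcc_of_le ht]; exact Icc_subset_Icc_right htT
  have s2 : uIcc T t ⊆ uIcc 0 t := by
    rw [uIcc_of_le htT, uIcc_of_le ht]; exact Icc_subset_Icc_left hT0
  have h1 : ∫ s in (0 : ℝ)..T, ‖Phi α M (t - s)‖ * ‖x s‖
      ≤ C * ∫ s in (0 : ℝ)..T, ‖Phi α M (t - s)‖ := by
    rw [mul_comm C, ← intervalIntegral.integral_mul_const]
    refine intervalIntegral.integral_mono_on hT0 (hi.mono_set s1)
      ((hΦi.mono_set s1).mul_const _) fun s hs => ?_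
    gcongr
    exact hC s hs.1
  have h2 : ∫ s in T..t, ‖Phi α M (t - s)‖ * ‖x s‖ ≤ K1 * L := by
    calc _ ≤ ∫ s in T..t, ‖Phi α M (t - s)‖ * L := by
          refine intervalIntegral.integral_mono_on htT (hi.mono_set s2)
            ((hΦi.mono_set s2).mul_const _) fun s hs => ?_
          gcongr
          exact hT s hs.1
      _ ≤ _ := by
        rw [intervalIntegral.integral_mul_const]
        gcongr
        refine le_trans ?_ (hΦ.2.2 t ht)
        rw [← intervalIntegral.integral_add_adjacent_intervals (hΦi.mono_set s1)
          (hΦi.mono_set s2)]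
        have : 0 ≤ ∫ s in (0 : ℝ)..T, ‖Phi α M (t - s)‖ :=
          intervalIntegral.integral_nonneg hT0 fun s _ => norm_nonneg _
        linarith
  rw [← intervalIntegral.integral_add_adjacent_intervals (hi.mono_set s1) (hi.mono_set s2)] at h
  have h3 := mul_le_mul_of_nonneg_left (add_le_add h1 h2) hc
  linarith

/-- If every eventual bound on `‖x‖` contracts by a factor `q < 1` up to an arbitrarily small error,
then the infimum of the eventual bounds, that is `limsup ‖x‖`, is zero. -/
lemma tendsto_zero_of_eventually_le_contraction {F : Type*} [NormedAddCommGroup F] {x : ℝ → F}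
    {q : ℝ} (hq : q < 1) (hq0 : 0 ≤ q) {C : ℝ} (hC : 0 ≤ C) (hxC : ∀ᶠ t in atTop, ‖x t‖ ≤ C)
    (hstep : ∀ L, 0 ≤ L → (∀ᶠ t in atTop, ‖x t‖ ≤ L) → ∀ ε, 0 < ε →
      ∀ᶠ t in atTop, ‖x t‖ ≤ q * L + ε) : Tendsto x atTop (𝓝 0) := by
  set A : Set ℝ := {L | 0 ≤ L ∧ ∀ᶠ t in atTop, ‖x t‖ ≤ L} with hA
  have hne : A.Nonempty := ⟨C, hC, hxC⟩
  have hbdd : BddBelow A := ⟨0, fun L hL => hL.1⟩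
  have hinf0 : 0 ≤ sInf A := le_csInf hne fun L hL => hL.1
  have hinf : sInf A = 0 := by
    by_contra hcon
    have hpos : 0 < sInf A := lt_of_le_of_ne hinf0 (Ne.symm hcon)
    set η := (1 - q) * sInf A / 3 with hη
    have hη0 : 0 < η := by have := sub_pos.2 hq; positivity
    obtain ⟨L, hLA, hL⟩ := exists_lt_of_csInf_lt hne (lt_add_of_pos_right (sInf A) hη0)
    have hmem : q * L + η ∈ A :=
      ⟨by have := mul_nonneg hq0 hLA.1; linarith, hstep L hLA.1 hLA.2 η hη0⟩
    have h1 := csInf_le hbdd hmem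
    have h2 : q * L ≤ q * sInf A + η := by
      have := mul_le_mul_of_nonneg_left hL.le hq0
      nlinarith
    linarith
  rw [tendsto_zero_iff_norm_tendsto_zero, Metric.tendsto_nhds]
  intro ε hε
  obtain ⟨L, hLA, hL⟩ := exists_lt_of_csInf_lt hne (hinf ▸ hε)
  filter_upwards [hLA.2] with t ht
  simpa using lt_of_le_of_lt ht hL

theorem CaputoRegular.tendsto_zero [FiniteDimensional ℝ E] (hα : 0 < α)
    (hΦ : PhiBounds α M K0j K0 K1)
    (hK0j : ∀ j < order α, Tendsto (K0j j) atTop (𝓝 0)) (hx : CaputoRegular α x)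
    (hp : ∀ᵐ t ∂volume.restrict (Ioi (0 : ℝ)), ‖caputoDeriv α x t - M (x t)‖ ≤ c * ‖x t‖)
    (hc : 0 ≤ c) (hK : K1 * c < 1) : Tendsto x atTop (𝓝 0) := by
  have hR : ∀ j < order α, ‖dtime j x 0‖ ≤ ∑ i ∈ Finset.range (order α), ‖dtime i x 0‖ :=
    fun j hj => Finset.single_le_sum (f := fun i => ‖dtime i x 0‖)
      (fun i _ => norm_nonneg _) (Finset.mem_range.2 hj)
  have hC := fun t (ht : 0 ≤ t) => hx.norm_le_of_norm_dtime_le hα hΦ hp hc hK hR ht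
  refine tendsto_zero_of_eventually_le_contraction hK (mul_nonneg hΦ.nonneg_right hc)
    ((norm_nonneg _).trans (hC 0 le_rfl)) ((eventually_ge_atTop 0).mono hC) ?_
  exact fun L hL0 hL ε hε => hx.eventually_norm_le hα hΦ hK0j hp hc hC hL0 hL hε

end Estimate

/-! ### The closed loop -/

section ClosedLoop

variable {E U : Type*} [NormedAddCommGroup E] [NormedSpace ℝ E]
  [NormedAddCommGroup U] [NormedSpace ℝ U] {r : ℕ}
  (S : LinearSystem E U r) (K : Feedback E U r)

lemma norm_le_supNorm {F : Type*} [Norm F] {f : ℝ → F} (hf : BoundedOnHalfLine f) {t : ℝ}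
    (ht : 0 ≤ t) : ‖f t‖ ≤ supNorm f :=
  le_ciSup hf (⟨t, ht⟩ : Ici (0 : ℝ))

lemma supNorm_nonneg {F : Type*} [SeminormedAddCommGroup F] (f : ℝ → F) : 0 ≤ supNorm f :=
  Real.iSup_nonneg fun _ => norm_nonneg _

lemma dtime_zero (j : ℕ) : dtime j (fun _ : ℝ => (0 : E)) = fun _ => 0 := by
  ext t
  simp [dtime]

lemma LinearSystem.isTrajectory_zero : S.IsTrajectory K (fun _ => 0) := by
  refine ⟨⟨contDiffOn_const, fun T _ => ?_⟩, ae_of_all _ fun t => ?_⟩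
  · rw [dtime_zero]
    simpa [AbsolutelyContinuousOnInterval] using tendsto_const_nhds
  · simp [caputoDeriv, dtime_zero, Feedback.control]

/-- Stability as soon as, along every trajectory, the closed loop differs from `D^α x = M x` by at
most `c ‖x‖` with `K1 * c < 1`. -/
theorem LinearSystem.stable_of_perturbation_bound [FiniteDimensional ℝ E] {M : E →L[ℝ] E}
    {K0j : ℕ → ℝ → ℝ} {K0 K1 c : ℝ} (hΦ : PhiBounds S.α M K0j K0 K1) (hc : 0 ≤ c)
    (hK : K1 * c < 1)
    (hp : ∀ x, S.IsTrajectory K x → ∀ᵐ t ∂volume.restrict (Ioi (0 : ℝ)),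
      ‖caputoDeriv S.α x t - M (x t)‖ ≤ c * ‖x t‖) :
    S.GloballyStable K ∧
      ((∀ j < order S.α, Tendsto (K0j j) atTop (𝓝 0)) → S.GloballyAsymptoticallyStable K) := by
  have hbound := fun x (hx : S.IsTrajectory K x) (R : ℝ) hR (t : ℝ) (ht : 0 ≤ t) =>
    hx.1.norm_le_of_norm_dtime_le S.α_pos hΦ (hp x hx) hc hK (R := R) hR ht
  have hst : S.GloballyStable K := by
    refine ⟨S.isTrajectory_zero K, fun ε hε => ?_, fun R => ⟨_, fun x hx hR t ht =>
      hbound x hx R hR t ht⟩⟩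
    have h1 : 0 < 1 - K1 * c := by linarith
    have h0 : 0 ≤ (order S.α : ℝ) * K0 := mul_nonneg (Nat.cast_nonneg _) (hΦ.nonneg_left S.α_pos)
    refine ⟨ε * (1 - K1 * c) / (order S.α * K0 + 1), by positivity, fun x hx hδ t ht => ?_⟩
    refine (hbound x hx _ (fun j hj => (hδ j hj).le) t ht).trans_lt ?_
    rw [div_lt_iff₀ h1, ← mul_assoc, mul_div_assoc', div_lt_iff₀ (by positivity), mul_comm]
    have : 0 < ε * (1 - K1 * c) := by positivity
    gcongr
    linarith
  exact ⟨hst, fun h0 => ⟨hst, fun x hx => hx.1.tendsto_zero S.α_pos hΦ h0 (hp x hx) hc hK⟩⟩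

end ClosedLoop

end CaputoSystem

theorem theorem3p3 {E U : Type*}
    [NormedAddCommGroup E] [NormedSpace ℝ E] [FiniteDimensional ℝ E]
    [NormedAddCommGroup U] [NormedSpace ℝ U] [FiniteDimensional ℝ U]
    {r : ℕ} (S : CaputoSystem.LinearSystem E U r) (K : CaputoSystem.Feedback E U r)
    (K0j : ℕ → ℝ → ℝ) (Kbar0 Kbar1 : ℝ) :
    -- (i)
    (∀ Kb : Fin (r + 1) → ℝ,
      CaputoSystem.PhiBounds S.α (∑ i, S.A i) K0j Kbar0 Kbar1 →
      (∀ x : ℝ → E, S.IsTrajectory K x → ∀ i, ∀ t : ℝ, 0 ≤ t → ‖K.along i x t‖ ≤ Kb i) →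
      Kbar1 * ∑ i, (CaputoSystem.supNorm (S.At i) + CaputoSystem.supNorm S.B * Kb i) < 1 →
      S.GloballyStable K ∧
        ((∀ j < CaputoSystem.order S.α, Tendsto (K0j j) atTop (𝓝 0)) →
          S.GloballyAsymptoticallyStable K)) ∧
    -- (ii)
    (∀ (Kb : Fin r → ℝ) (L : E →L[ℝ] U) (G : E →L[ℝ] E),
      (∀ x : ℝ → E, S.IsTrajectory K x → ∀ t : ℝ, 0 ≤ t → K.along 0 x t = L) →
      (∀ t : ℝ, 0 ≤ t → (S.B t).comp L = G) →
      CaputoSystem.PhiBounds S.α ((∑ i, S.A i) + G) K0j Kbar0 Kbar1 →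
      (∀ x : ℝ → E, S.IsTrajectory K x → ∀ i : Fin r, ∀ t : ℝ, 0 ≤ t →
        ‖K.along i.succ x t‖ ≤ Kb i) →
      Kbar1 * (∑ i, CaputoSystem.supNorm (S.At i) +
        CaputoSystem.supNorm S.B * ∑ i, Kb i) < 1 →
      S.GloballyStable K ∧
        ((∀ j < CaputoSystem.order S.α, Tendsto (K0j j) atTop (𝓝 0)) →
          S.GloballyAsymptoticallyStable K)) := by
  open CaputoSystem in
  have hB := supNorm_nonneg S.B
  have hAt : ∀ (x : ℝ → E) (t : ℝ), 0 ≤ t →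
      ‖∑ i, S.At i t (x t)‖ ≤ (∑ i, supNorm (S.At i)) * ‖x t‖ := by
    intro x t ht
    rw [Finset.sum_mul]
    refine (norm_sum_le _ _).trans (Finset.sum_le_sum fun i _ => ?_)
    exact (S.At i t).le_of_opNorm_le (norm_le_supNorm (S.At_bdd i) ht) _
  have hBK : ∀ {ι : Type} [Fintype ι] (κ : ι → E →L[ℝ] U) (Kb : ι → ℝ) (x : ℝ → E) (t : ℝ),
      0 ≤ t → (∀ i, ‖κ i‖ ≤ Kb i) →
      ‖S.B t (∑ i, κ i (x t))‖ ≤ supNorm S.B * (∑ i, Kb i) * ‖x t‖ := by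
    intro ι _ κ Kb x t ht hκ
    rw [mul_assoc, Finset.sum_mul]
    refine ((S.B t).le_of_opNorm_le (norm_le_supNorm S.B_bdd ht) _).trans ?_
    gcongr
    refine (norm_sum_le _ _).trans (Finset.sum_le_sum fun i _ => ?_)
    exact (κ i).le_of_opNorm_le (hκ i) _
  constructor
  · intro Kb hΦ hKb hlt
    -- The zero trajectory exists, so the gain bounds are nonnegative.
    have hKb0 : ∀ i, 0 ≤ Kb i := fun i =>
      (norm_nonneg _).trans (hKb _ (S.isTrajectory_zero K) i 0 le_rfl)
    refine S.stable_of_perturbation_bound K hΦ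
      (Finset.sum_nonneg fun i _ => add_nonneg (supNorm_nonneg _) (mul_nonneg hB (hKb0 i))) hlt
      fun x hx => ?_
    filter_upwards [hx.2, ae_restrict_mem measurableSet_Ioi] with t heq ht
    have ht0 : 0 ≤ t := le_of_lt ht
    have e : caputoDeriv S.α x t - (∑ i, S.A i) (x t)
        = ∑ i, S.At i t (x t) + S.B t (∑ i, K.along i x t (x t)) := by
      rw [heq, Feedback.control]
      simp only [add_apply, sum_apply,
        Finset.sum_add_distrib]
      abel
    rw [e, Finset.sum_add_distrib, ← Finset.mul_sum, add_mul]
    exact (norm_add_le _ _).trans (add_le_add (hAt x t ht0)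
      (hBK _ Kb x t ht0 fun i => hKb x hx i t ht0))
  · intro Kb L G hL hG hΦ hKb hlt
    -- The zero trajectory exists, so the gain bounds are nonnegative.
    have hKb0 : ∀ i, 0 ≤ Kb i := fun i =>
      (norm_nonneg _).trans (hKb _ (S.isTrajectory_zero K) i 0 le_rfl)
    refine S.stable_of_perturbation_bound K hΦ
      (add_nonneg (Finset.sum_nonneg fun i _ => supNorm_nonneg _)
        (mul_nonneg hB (Finset.sum_nonneg fun i _ => hKb0 i))) hlt fun x hx => ?_
    filter_upwards [hx.2, ae_restrict_mem measurableSet_Ioi] with t heq ht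
    have ht0 : 0 ≤ t := le_of_lt ht
    have e : caputoDeriv S.α x t - ((∑ i, S.A i) + G) (x t)
        = ∑ i, S.At i t (x t) + S.B t (∑ i : Fin r, K.along i.succ x t (x t)) := by
      rw [heq, Feedback.control, Fin.sum_univ_succ (fun i => K.along i x t (x t)),
        hL x hx t ht0, map_add, ← hG t ht0]
      simp only [add_apply, sum_apply,
        ContinuousLinearMap.comp_apply, Finset.sum_add_distrib]
      abel
    rw [e, add_mul]
    exact (norm_add_le _ _).trans (add_le_add (hAt x t ht0)
      (hBK _ Kb x t ht0 fun i => hKb x hx i t ht0))
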